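/- **Setting.** Fix constants $a_\phi,l_\phi,\phi^*>0$. For every sample size $n$ let $X$ be an $n\times p$ real matrix; a model $M_k$ is given by a set $k$ of $p_k\le\bar p$ columns of $X$, which form the matrix $X_k$, and $X_k'X_k$ is invertible whenever $p_k\le\bar p$. All models have positive prior probabilities $p(M_k)$ summing to one, where $p(M_k)$ depends on $k$ only through $p_k$; put $r_{p_k,p_l}=p(M_k)/p(M_l)$. Under $M_k$, $$\mathbf y\mid\boldsymbol\theta_k,\phi\sim N(X_k\boldsymbol\theta_k,\phi I),\qquad \boldsymbol\theta_k\mid\phi\sim N(\mathbf 0,\tau\phi V_k),\qquad \phi\sim \mathrm{IG}(a_\phi/2,l_\phi/2),$$ with $\tau>0$ and $V_k$ symmetric positive definite, and $p(M_k\mid\mathbf y)\propto p(\mathbf y\mid M_k)\,p(M_k)$ is the posterior probability, normalized over all models with $p_k\le\bar p$. The data are generated by $f^*(\mathbf y)=N(\mathbf y;X_t\boldsymbol\theta^*_t,\phi^*I)$ for a model $M_t$. The quantities $X,p,\bar p,\tau,V_k,t,\boldsymbol\theta_t^*$, the model prior and the model $m$ below may all depend on $n$. For positive $b_n$, $a_n\ll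 b_n$ means $a_n/b_n\to0$ as $n\to\infty$, and $a_n\asymp b_n$ means that $a_n/b_n$ is bounded away from $0$ and $\infty$ for large $n$. Let $S$ be the set of spurious models ($t\subsetneq m$, $p_m\le\bar p$) and $S^c$ the set of non-spurious models ($t\not\subseteq m$, $p_m\le\bar p$). Let $\rho_{k1}\ge\dots\ge\rho_{kp_k}>0$ be the eigenvalues of $V_kX_k'X_k$, and $$\lambda_{tm}=(X_t\boldsymbol\theta_t^*)'\bigl(I-X_m(X_m'X_m)^{-1}X_m'\bigr)X_t\boldsymbol\theta_t^*/\phi^*,\qquad \lambda_{t0}=(X_t\boldsymbol\theta_t^*)'X_t\boldsymbol\theta_t^*/\phi^*.$$ **Conditions.** - (B1) $\bar p\ll\min\{n,p\}$ and $\tau\gg\bar p$. - (B2) For some constant $\beta_1\in(0,1)$, $\lambda_{tm}^{\beta_1}\gg p_q$ with $M_q=M_t\cup M_m$, uniformly over $m\in S^c$. - (C1), for $m\in S$: $\tau\to\infty$, and $r_{p_m,p_t}\ll\tau^{\beta_2(p_m-p_t)/2}$ for some fixed $\beta_2\in(0,1)$. - (C2), for $m\in S^c$: for every fixed $\beta_3\in(0,1)$,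 $b_n=\lambda_{tm}^{\beta_3}+(p_m-p_t)\log(1+\tau)$ is positive for all large $n$, and $\limsup_{n\to\infty}\log(r_{p_m,p_t})/b_n\le0$. - (D1), for the model $m$: $\prod_{j=1}^{p_m}(\tau\rho_{mj}+1)^{1/2}\big/\prod_{j=1}^{p_t}(\tau\rho_{tj}+1)^{1/2}\asymp(c_{mt}\tau)^{(p_m-p_t)/2}$ for some constant $c_{mt}>0$. - (D2) $\lambda_{t0}\ll\tau\rho_{tp_t}$ (required when $p_t\ge1$). **Proposition.** Assume (B1), (B2) and (D2). (i) Let $m\in S$ satisfy (C1) and (D1). Then for all fixed $\alpha\in(0,1)$ and $\kappa>0$, $$E_{f^*}(p(M_m\mid\mathbf y))\ll\max\left\{r_{p_m,p_t}^{\alpha}\,\tau^{\alpha(p_t-p_m)/2},\;e^{-\kappa n},\;e^{-\tau\rho_{tp_t}/2}\right\},$$ where the last term is absent when $p_t=0$. (ii) Let $m\in S^c$ satisfy (C2) and (D1), and suppose that $\lambda_{tm}$ grows at most polynomially in $n$, i.e. $\lambda_{tm}=O(n^K)$ for some fixed $K$. Then for all fixed $\gamma,\alpha\in(0,1)$ and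 $\kappa>0$, $$E_{f^*}(p(M_m\mid\mathbf y))\ll\exp\left\{-\min\left\{\gamma\lambda_{tm}^{\alpha}/2,\;\kappa n,\;\tau\rho_{tp_t}/2\right\}\right\}.$$ -/

import Mathlib

open MeasureTheory ProbabilityTheory Filter Asymptotics Set
open scoped Matrix ENNReal

noncomputable section

namespace BMS

/-- The density at `x` of the multivariate normal distribution with mean `μ` and (positive
definite) covariance matrix `C`. -/
def normalPdf {ι : Type} [Fintype ι] [DecidableEq ι] (μ : ι → ℝ) (C : Matrix ι ι ℝ)
    (x : ι → ℝ) : ℝ :=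
  (Real.sqrt ((2 * Real.pi) ^ Fintype.card ι * C.det))⁻¹ *
    Real.exp (-((x - μ) ⬝ᵥ (C⁻¹ *ᵥ (x - μ))) / 2)

/-- The density at `x > 0` of the inverse gamma distribution with shape `a` and scale `b`. -/
def invGammaPdf (a b x : ℝ) : ℝ :=
  b ^ a / Real.Gamma a * x ^ (-(a + 1)) * Real.exp (-b / x)

/-- The matrix `X_k` of the columns of `X` selected by the model `k`. -/
def cols {n p : ℕ} (X : Matrix (Fin n) (Fin p) ℝ) (k : Finset (Fin p)) :
    Matrix (Fin n) k ℝ :=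
  X.submatrix id (fun j => (j : Fin p))

/-- The Gram matrix `X_k' X_k`. -/
def gram {n p : ℕ} (X : Matrix (Fin n) (Fin p) ℝ) (k : Finset (Fin p)) : Matrix k k ℝ :=
  (cols X k)ᵀ * cols X k

/-- A Bayesian variable selection problem with sample size `n`. A model is a set `k` of at
most `pbar` columns of `X`. -/
structure Problem (n : ℕ) where
  /-- number of variables -/
  p : ℕ
  /-- design matrix -/
  X : Matrix (Fin n) (Fin p) ℝ
  /-- maximum model size -/
  pbar : ℕ
  gram_isUnit : ∀ k : Finset (Fin p), k.card ≤ pbar → IsUnit (gram X k).det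
  /-- `prior l` is the prior probability of each single model with `l` variables -/
  prior : ℕ → ℝ
  prior_pos : ∀ k : Finset (Fin p), k.card ≤ pbar → 0 < prior k.card
  prior_sum : ∑ k : Finset (Fin p) with k.card ≤ pbar, prior k.card = 1
  /-- prior dispersion -/
  tau : ℝ
  tau_pos : 0 < tau
  /-- the prior covariance of the coefficients under model `k` is `tau * φ * V k` -/
  V : (k : Finset (Fin p)) → Matrix k k ℝ
  V_posDef : ∀ k : Finset (Fin p), k.card ≤ pbar → (V k).PosDef
  /-- the true model -/
  t : Finset (Fin p)
  t_card : t.card ≤ pbar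
  /-- the true regression coefficients -/
  theta : t → ℝ

namespace Problem

variable {n : ℕ} (D : Problem n)

/-- The mean `X_t θ_t` of the data-generating distribution. -/
def mean : Fin n → ℝ := cols D.X D.t *ᵥ D.theta

/-- The data-generating distribution `N(X_t θ_t, φ I)`. -/
def truth (φ : ℝ) : Measure (Fin n → ℝ) :=
  Measure.pi fun i => gaussianReal (D.mean i) φ.toNNReal

/-- The integrated likelihood `p(y | M_k)` under `y ~ N(X_k θ, φ I)`, `θ | φ ~ N(0, τ φ V_k)` and
`φ ~ IG(a / 2, l / 2)`. -/
def evidence (a l : ℝ) (k : Finset (Fin D.p)) (y : Fin n → ℝ) : ℝ≥0∞ :=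
  ∫⁻ φ in Ioi (0 : ℝ), ∫⁻ θ : k → ℝ, ENNReal.ofReal
    (normalPdf (cols D.X k *ᵥ θ) (φ • (1 : Matrix (Fin n) (Fin n) ℝ)) y *
      normalPdf 0 ((D.tau * φ) • D.V k) θ * invGammaPdf (a / 2) (l / 2) φ)

/-- The posterior probability `p(M_m | y)`. -/
def posterior (a l : ℝ) (m : Finset (Fin D.p)) (y : Fin n → ℝ) : ℝ :=
  (D.evidence a l m y * ENNReal.ofReal (D.prior m.card) /
    ∑ k : Finset (Fin D.p) with k.card ≤ D.pbar,
      D.evidence a l k y * ENNReal.ofReal (D.prior k.card)).toReal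

/-- The expectation of `p(M_m | y)` under the data-generating distribution. -/
def meanPosterior (a l φ : ℝ) (m : Finset (Fin D.p)) : ℝ :=
  ∫ y, D.posterior a l m y ∂(D.truth φ)

/-- `m` is a spurious model: it strictly contains the true model. -/
def Spurious (m : Finset (Fin D.p)) : Prop := D.t ⊂ m ∧ m.card ≤ D.pbar

/-- `m` is a non-spurious model: it does not contain the true model. -/
def NonSpurious (m : Finset (Fin D.p)) : Prop := ¬ D.t ⊆ m ∧ m.card ≤ D.pbar

/-- The prior odds `p(M_m) / p(M_t)`. -/
def odds (m : Finset (Fin D.p)) : ℝ := D.prior m.card / D.prior D.t.card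

/-- `p_m - p_t`, which may be negative. -/
def sizeDiff (m : Finset (Fin D.p)) : ℝ := (m.card : ℝ) - (D.t.card : ℝ)

/-- The non-centrality parameter
`(X_t θ_t)' (I - X_m (X_m' X_m)⁻¹ X_m') X_t θ_t / φ`; for `m = ∅` this is
`(X_t θ_t)' X_t θ_t / φ`. -/
def lam (φ : ℝ) (m : Finset (Fin D.p)) : ℝ :=
  (D.mean ⬝ᵥ ((1 - cols D.X m * (gram D.X m)⁻¹ * (cols D.X m)ᵀ) *ᵥ D.mean)) / φ

/-- The eigenvalues of `V_k X_k' X_k`, with multiplicities. -/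
def rho (k : Finset (Fin D.p)) : Multiset ℝ := (D.V k * gram D.X k).charpoly.roots

/-- The smallest eigenvalue of `V_t X_t' X_t`. It is only meaningful for `t ≠ ∅`. -/
def rhoMin : ℝ := sInf {x | x ∈ D.rho D.t}

/-- `∏ j, (τ ρ_{kj} + 1) ^ (1 / 2)`. -/
def rhoProd (k : Finset (Fin D.p)) : ℝ :=
  ((D.rho k).map fun x => (D.tau * x + 1) ^ (1 / 2 : ℝ)).prod

/-- `exp (-τ ρ_{t p_t} / 2)`, where the smallest element of the empty list of eigenvalues of the
model without variables counts as `+∞`. -/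
def rhoTail : ℝ := if D.t = ∅ then 0 else Real.exp (-(D.tau * D.rhoMin / 2))

end Problem

/-- `pbar ≪ min {n, p}` and `pbar ≪ τ`. -/
def CondB1 (D : (n : ℕ) → Problem n) : Prop :=
  ((fun n => ((D n).pbar : ℝ)) =o[atTop] fun n => min (n : ℝ) ((D n).p : ℝ)) ∧
    ((fun n => ((D n).pbar : ℝ)) =o[atTop] fun n => (D n).tau)

/-- `p_q ≪ λ_{tm} ^ β₁` with `q = t ∪ m`, for all non-spurious `m`. As `m` may change with `n`,
this says that the rate is uniform in `m`. -/
def CondB2 (φ : ℝ) (D : (n : ℕ) → Problem n) : Prop :=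
  ∃ β ∈ Ioo (0 : ℝ) 1, ∀ C > (0 : ℝ), ∀ᶠ n in atTop, ∀ m, (D n).NonSpurious m →
    C * (((D n).t ∪ m).card : ℝ) ≤ (D n).lam φ m ^ β

/-- `τ ≫ 1` and `r_{p_m,p_t} ≪ τ ^ (β₂ (p_m - p_t) / 2)`. -/
def CondC1 (D : (n : ℕ) → Problem n) (m : (n : ℕ) → Finset (Fin (D n).p)) : Prop :=
  Tendsto (fun n => (D n).tau) atTop atTop ∧
    ∃ β ∈ Ioo (0 : ℝ) 1, (fun n => (D n).odds (m n)) =o[atTop] fun n =>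
      (D n).tau ^ (β * (D n).sizeDiff (m n) / 2)

/-- `log r_{p_m,p_t} ≪ λ_{tm} ^ β₃ + (p_m - p_t) log (1 + τ)` for all `β₃ ∈ (0, 1)`: the right-hand
side is eventually positive, and the left-hand side (which may be negative, and then imposes
nothing) is eventually below every positive multiple of it. -/
def CondC2 (φ : ℝ) (D : (n : ℕ) → Problem n) (m : (n : ℕ) → Finset (Fin (D n).p)) : Prop :=
  ∀ β ∈ Ioo (0 : ℝ) 1,
    (∀ᶠ n in atTop,
      0 < (D n).lam φ (m n) ^ β + (D n).sizeDiff (m n) * Real.log (1 + (D n).tau)) ∧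
    ∀ ε > (0 : ℝ), ∀ᶠ n in atTop, Real.log ((D n).odds (m n)) ≤
      ε * ((D n).lam φ (m n) ^ β + (D n).sizeDiff (m n) * Real.log (1 + (D n).tau))

/-- `∏ j, (τ ρ_{mj} + 1) ^ (1 / 2) / ∏ j, (τ ρ_{tj} + 1) ^ (1 / 2) ≍ (c τ) ^ ((p_m - p_t) / 2)`
for a constant `c > 0`. -/
def CondD1 (D : (n : ℕ) → Problem n) (m : (n : ℕ) → Finset (Fin (D n).p)) : Prop :=
  ∃ c > (0 : ℝ), (fun n => (D n).rhoProd (m n) / (D n).rhoProd (D n).t) =Θ[atTop] fun n =>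
    (c * (D n).tau) ^ ((D n).sizeDiff (m n) / 2)

/-- `λ_{t0} ≪ τ ρ_{t p_t}` (void for `t = ∅`, where both sides are zero). -/
def CondD2 (φ : ℝ) (D : (n : ℕ) → Problem n) : Prop :=
  (fun n => (D n).lam φ ∅) =o[atTop] fun n => (D n).tau * (D n).rhoMin

/-- The signal strength `λ_{tm}` grows at most polynomially in `n`. -/
def PolySignal (φ : ℝ) (D : (n : ℕ) → Problem n) (m : (n : ℕ) → Finset (Fin (D n).p)) : Prop :=
  ∃ K : ℕ, (fun n => (D n).lam φ (m n)) =O[atTop] fun n => (n : ℝ) ^ K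

end BMS

end

/-!
Integrating out the coefficients and the error variance, the posterior odds of `m` against `t` are
the prior odds times `rhoProd t / rhoProd m` times the power `(n + a) / 2` of
`(l + fit t) / (l + fit m)`, where `fit` is the residual sum of squares of a ridge regression. It is
at least the least squares residual sum `rss`, and for the true model it exceeds `rss` by at most a
bounded amount, except with a probability that (D2) makes negligible against `exp (-τ ρ / 2)`.

If `m` is spurious, the ratio of residual sums is `1 + U / (l + R)` with `U / φ` and `R / φ`
independent chi-square variables with `p_m - p_t` and `n - p_m` degrees of freedom. Its power `s ν`
with `s < 1` and `ν = (n - p_m) / 2` is dominated by a series of exponentials of quadratic forms in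
the noise and so has a moment of order `(1 - s) ^ (-(p_m - p_t) / 2)`. A probability is at most its
own power `s`, and as `α < s < 1` the excess power of the odds absorbs that moment.

If `m` is non-spurious, the residual sum of `m` exceeds that of `t` by a multiple of `λ`, up to
Chernoff bounds that are exponentially small in `λ` or `n`. The posterior odds are then at most
`exp (2 λ ^ b) (1 + λ / (c n)) ^ (-n / 2)`, which is negligible against `exp (-min (λ ^ α) n)`.
-/

noncomputable section

namespace BMS

section Gaussian

variable {ι : Type} [Fintype ι]

/-- The normal distribution `N(μ, φ I)`, encoded as a product of one-dimensional normal
distributions. -/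
def isotropicGaussian (μ : ι → ℝ) (φ : ℝ) : Measure (ι → ℝ) :=
  Measure.pi fun i => gaussianReal (μ i) φ.toNNReal

instance isProbabilityMeasure_isotropicGaussian (μ : ι → ℝ) (φ : ℝ) :
    IsProbabilityMeasure (isotropicGaussian μ φ) := by
  unfold isotropicGaussian
  infer_instance

theorem prod_gaussianPDFReal (μ x : ι → ℝ) {φ : ℝ} (hφ : 0 < φ) :
    ∏ i, gaussianPDFReal (μ i) φ.toNNReal (x i) =
      (√(2 * Real.pi * φ) ^ Fintype.card ι)⁻¹ *
        Real.exp (-((x - μ) ⬝ᵥ (x - μ)) / (2 * φ)) := by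
  simp only [gaussianPDFReal, Finset.prod_mul_distrib, Finset.prod_const, Finset.card_univ,
    Real.coe_toNNReal _ hφ.le, inv_pow, ← Real.exp_sum, dotProduct, Pi.sub_apply, ← sq]
  rw [← Finset.sum_div, Finset.sum_neg_distrib]

theorem isotropicGaussian_eq_withDensity (μ : ι → ℝ) {φ : ℝ} (hφ : 0 < φ) :
    isotropicGaussian μ φ =
      volume.withDensity fun x => ENNReal.ofReal ((√(2 * Real.pi * φ) ^ Fintype.card ι)⁻¹ *
        Real.exp (-((x - μ) ⬝ᵥ (x - μ)) / (2 * φ))) := by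
  have hv : φ.toNNReal ≠ 0 := by simpa using hφ
  simp only [← prod_gaussianPDFReal _ _ hφ]
  refine Measure.pi_eq fun s hs => ?_
  rw [withDensity_apply _ (MeasurableSet.univ_pi hs), volume_pi, Measure.restrict_pi_pi,
    ← ofReal_integral_eq_lintegral_ofReal]
  · rw [integral_fintype_prod_eq_prod (f := fun i x => gaussianPDFReal (μ i) φ.toNNReal x),
      ENNReal.ofReal_prod_of_nonneg
        (fun i _ => integral_nonneg fun x => gaussianPDFReal_nonneg _ _ _)]
    exact Finset.prod_congr rfl fun i _ => (gaussianReal_apply_eq_integral _ hv _).symm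
  · exact Integrable.fintype_prod (f := fun i x => gaussianPDFReal (μ i) φ.toNNReal x)
      fun i => (integrable_gaussianPDFReal _ _).integrableOn
  · exact ae_of_all _ fun x => Finset.prod_nonneg fun i _ => gaussianPDFReal_nonneg _ _ _

theorem lintegral_isotropicGaussian (μ : ι → ℝ) {φ : ℝ} (hφ : 0 < φ) {F : (ι → ℝ) → ℝ≥0∞}
    (hF : Measurable F) :
    ∫⁻ y, F y ∂(isotropicGaussian μ φ) =
      ENNReal.ofReal (√(2 * Real.pi * φ) ^ Fintype.card ι)⁻¹ *
        ∫⁻ x : ι → ℝ, ENNReal.ofReal (Real.exp (-(x ⬝ᵥ x) / (2 * φ))) * F (x + μ) := by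
  rw [isotropicGaussian_eq_withDensity μ hφ, lintegral_withDensity_eq_lintegral_mul _ _ hF]
  · rw [← lintegral_add_right_eq_self _ μ, ← lintegral_const_mul]
    · refine lintegral_congr fun x => ?_
      rw [Pi.mul_apply, ENNReal.ofReal_mul (by positivity), add_sub_cancel_right, mul_assoc]
    · simp only [dotProduct]
      fun_prop
  · simp only [dotProduct, Pi.sub_apply]
    fun_prop

theorem lintegral_exp_neg_dotProduct_self {φ : ℝ} (hφ : 0 < φ) :
    ∫⁻ x : ι → ℝ, ENNReal.ofReal (Real.exp (-(x ⬝ᵥ x) / (2 * φ))) =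
      ENNReal.ofReal (√(2 * Real.pi * φ) ^ Fintype.card ι) := by
  have h := lintegral_isotropicGaussian (0 : ι → ℝ) hφ (F := fun _ => 1) measurable_const
  have hpos : 0 < √(2 * Real.pi * φ) ^ Fintype.card ι := by positivity
  simp only [lintegral_const, measure_univ, mul_one] at h
  rw [ENNReal.ofReal_inv_of_pos hpos] at h
  rw [← ENNReal.div_eq_one_iff (by rwa [Ne, ENNReal.ofReal_eq_zero, not_le]) (by simp),
    ENNReal.div_eq_inv_mul, ← h]

theorem lintegral_exp_dotProduct (μ v : ι → ℝ) {φ : ℝ} (hφ : 0 < φ) :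
    ∫⁻ y, ENNReal.ofReal (Real.exp (v ⬝ᵥ (y - μ))) ∂(isotropicGaussian μ φ) =
      ENNReal.ofReal (Real.exp (φ * (v ⬝ᵥ v) / 2)) := by
  have hpos : 0 < √(2 * Real.pi * φ) ^ Fintype.card ι := by positivity
  have complete_square : ∀ x : ι → ℝ, ENNReal.ofReal (Real.exp (-(x ⬝ᵥ x) / (2 * φ))) *
      ENNReal.ofReal (Real.exp (v ⬝ᵥ (x + μ - μ))) =
      ENNReal.ofReal (Real.exp (-((x - φ • v) ⬝ᵥ (x - φ • v)) / (2 * φ))) *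
        ENNReal.ofReal (Real.exp (φ * (v ⬝ᵥ v) / 2)) := by
    intro x
    rw [← ENNReal.ofReal_mul (by positivity), ← ENNReal.ofReal_mul (by positivity),
      ← Real.exp_add, ← Real.exp_add, add_sub_cancel_right]
    congr 2
    simp only [sub_dotProduct, dotProduct_sub, smul_dotProduct, dotProduct_smul, smul_eq_mul,
      dotProduct_comm x v]
    field_simp
    ring
  rw [lintegral_isotropicGaussian μ hφ (by simp only [dotProduct, Pi.sub_apply]; fun_prop)]
  simp only [complete_square]
  rw [lintegral_mul_const _ (by simp only [dotProduct, Pi.sub_apply]; fun_prop),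
    lintegral_sub_right_eq_self
      (fun x : ι → ℝ => ENNReal.ofReal (Real.exp (-(x ⬝ᵥ x) / (2 * φ)))),
    lintegral_exp_neg_dotProduct_self hφ, ← mul_assoc, ← ENNReal.ofReal_mul (by positivity),
    inv_mul_cancel₀ hpos.ne', ENNReal.ofReal_one, one_mul]

variable [DecidableEq ι]

open scoped MatrixOrder in
theorem exists_eq_transpose_mul_self_of_posDef {A : Matrix ι ι ℝ} (hA : A.PosDef) :
    ∃ B : Matrix ι ι ℝ, B.det ≠ 0 ∧ A = Bᵀ * B := by
  obtain ⟨B, rfl⟩ := CStarAlgebra.nonneg_iff_eq_star_mul_self.1 hA.posSemidef.nonneg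
  refine ⟨B, fun h => ?_, rfl⟩
  exact hA.det_pos.ne' (by rw [Matrix.det_mul, h, mul_zero])

theorem lintegral_exp_neg_posDef {A : Matrix ι ι ℝ} (hA : A.PosDef) {φ : ℝ} (hφ : 0 < φ) :
    ∫⁻ x : ι → ℝ, ENNReal.ofReal (Real.exp (-(x ⬝ᵥ (A *ᵥ x)) / (2 * φ))) =
      ENNReal.ofReal (√(2 * Real.pi * φ) ^ Fintype.card ι * (√A.det)⁻¹) := by
  obtain ⟨B, hB, rfl⟩ := exists_eq_transpose_mul_self_of_posDef hA
  have change_of_variables := lintegral_map (μ := volume)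
    (f := fun x : ι → ℝ => ENNReal.ofReal (Real.exp (-(x ⬝ᵥ x) / (2 * φ))))
    (by simp only [dotProduct]; fun_prop)
    (LinearMap.continuous_on_pi (Matrix.toLin' B)).measurable
  rw [Real.map_matrix_volume_pi_eq_smul_volume_pi hB, lintegral_smul_measure,
    lintegral_exp_neg_dotProduct_self hφ, smul_eq_mul] at change_of_variables
  have sqrt_det : √(Bᵀ * B).det = |B.det| := by
    rw [Matrix.det_mul, Matrix.det_transpose, ← sq, Real.sqrt_sq_eq_abs]
  rw [sqrt_det, mul_comm (√_ ^ _), ENNReal.ofReal_mul (by positivity), ← abs_inv,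
    change_of_variables]
  refine lintegral_congr fun x => ?_
  rw [Matrix.toLin'_apply, ← Matrix.mulVec_mulVec, Matrix.dotProduct_mulVec,
    Matrix.vecMul_transpose]

theorem lintegral_exp_quadraticForm (μ : ι → ℝ) {φ : ℝ} (hφ : 0 < φ) {M : Matrix ι ι ℝ}
    (hM : (1 - M).PosDef) :
    ∫⁻ y, ENNReal.ofReal (Real.exp (((y - μ) ⬝ᵥ (M *ᵥ (y - μ))) / (2 * φ)))
        ∂(isotropicGaussian μ φ) =
      ENNReal.ofReal (√(1 - M).det)⁻¹ := by
  have hpos : 0 < √(2 * Real.pi * φ) ^ Fintype.card ι := by positivity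
  have tilt : ∀ x : ι → ℝ, ENNReal.ofReal (Real.exp (-(x ⬝ᵥ x) / (2 * φ))) *
      ENNReal.ofReal (Real.exp (((x + μ - μ) ⬝ᵥ (M *ᵥ (x + μ - μ))) / (2 * φ))) =
      ENNReal.ofReal (Real.exp (-(x ⬝ᵥ ((1 - M) *ᵥ x)) / (2 * φ))) := by
    intro x
    rw [← ENNReal.ofReal_mul (by positivity), ← Real.exp_add, add_sub_cancel_right,
      Matrix.sub_mulVec, Matrix.one_mulVec, dotProduct_sub]
    ring_nf
  rw [lintegral_isotropicGaussian μ hφ]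
  · simp only [tilt]
    rw [lintegral_exp_neg_posDef hM hφ, ← ENNReal.ofReal_mul (by positivity), ← mul_assoc,
      inv_mul_cancel₀ hpos.ne', one_mul]
  · simp only [dotProduct, Matrix.mulVec, Pi.sub_apply]
    fun_prop

end Gaussian

section QuadraticForm

variable {ι : Type} [Fintype ι] {A : Matrix ι ι ℝ}

theorem dotProduct_self_nonneg_real (u : ι → ℝ) : 0 ≤ u ⬝ᵥ u :=
  Finset.sum_nonneg fun _ _ => mul_self_nonneg _

theorem quadraticForm_nonneg (hA : A.PosSemidef) (u : ι → ℝ) : 0 ≤ u ⬝ᵥ (A *ᵥ u) := by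
  simpa using hA.dotProduct_mulVec_nonneg u

theorem quadraticForm_add_le (hA : A.PosSemidef) (u v : ι → ℝ) :
    (u + v) ⬝ᵥ (A *ᵥ (u + v)) ≤ 2 * (u ⬝ᵥ (A *ᵥ u)) + 2 * (v ⬝ᵥ (A *ᵥ v)) := by
  have h := quadraticForm_nonneg hA (u - v)
  simp only [Matrix.mulVec_add, Matrix.mulVec_sub, dotProduct_add, add_dotProduct, dotProduct_sub,
    sub_dotProduct] at h ⊢
  linarith

end QuadraticForm

section Projection

variable {ι : Type} [Fintype ι] {P : Matrix ι ι ℝ}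

theorem dotProduct_mulVec_of_isStarProjection (hP : IsStarProjection P) (u v : ι → ℝ) :
    u ⬝ᵥ (P *ᵥ v) = (P *ᵥ u) ⬝ᵥ (P *ᵥ v) := by
  have hT : Pᵀ = P := hP.isSelfAdjoint
  nth_rw 1 [← hP.isIdempotentElem.eq]
  rw [← Matrix.mulVec_mulVec, Matrix.dotProduct_mulVec, ← Matrix.mulVec_transpose, hT]

open scoped MatrixOrder in
theorem posSemidef_of_isStarProjection (hP : IsStarProjection P) : P.PosSemidef :=
  Matrix.nonneg_iff_posSemidef.1 hP.nonneg

theorem quadraticForm_le_of_isStarProjection (hP : IsStarProjection P) (u : ι → ℝ) :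
    u ⬝ᵥ (P *ᵥ u) ≤ u ⬝ᵥ u := by
  classical
  have h := quadraticForm_nonneg (posSemidef_of_isStarProjection hP.one_sub) u
  rw [Matrix.sub_mulVec, Matrix.one_mulVec, dotProduct_sub] at h
  linarith

end Projection

section Hat

variable {ι κ : Type} [Fintype ι] [Fintype κ] [DecidableEq κ] {X : Matrix ι κ ℝ}

/-- The orthogonal projection onto the column space of `X`. It is one only if `X` has linearly
independent columns. -/
def hat (X : Matrix ι κ ℝ) : Matrix ι ι ℝ := X * (Xᵀ * X)⁻¹ * Xᵀ

theorem hat_transpose (X : Matrix ι κ ℝ) : (hat X)ᵀ = hat X := by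
  simp [hat, Matrix.transpose_mul, Matrix.transpose_nonsing_inv, Matrix.mul_assoc]

theorem hat_mul_self (hX : IsUnit (Xᵀ * X).det) : hat X * X = X := by
  rw [hat, Matrix.mul_assoc, Matrix.mul_assoc, Matrix.nonsing_inv_mul _ hX, Matrix.mul_one]

theorem hat_mul_hat {κ' : Type} [Fintype κ'] [DecidableEq κ'] {Y : Matrix ι κ' ℝ}
    (hYX : hat Y * X = X) : hat Y * hat X = hat X := by
  nth_rw 2 [hat]
  rw [← Matrix.mul_assoc, ← Matrix.mul_assoc, hYX, hat]

theorem isStarProjection_hat (hX : IsUnit (Xᵀ * X).det) : IsStarProjection (hat X) where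
  isIdempotentElem := hat_mul_hat (hat_mul_self hX)
  isSelfAdjoint := hat_transpose X

theorem hat_mulVec_mulVec (hX : IsUnit (Xᵀ * X).det) (θ : κ → ℝ) :
    hat X *ᵥ (X *ᵥ θ) = X *ᵥ θ := by
  rw [Matrix.mulVec_mulVec, hat_mul_self hX]

variable [DecidableEq ι]

theorem hat_one : hat (1 : Matrix ι ι ℝ) = 1 := by
  simp [hat]

theorem det_one_add_smul_hat (hX : IsUnit (Xᵀ * X).det) (c : ℝ) :
    (1 + c • hat X).det = (1 + c) ^ Fintype.card κ := by
  have factor : c • hat X = X * (c • ((Xᵀ * X)⁻¹ * Xᵀ)) := by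
    rw [hat, Matrix.mul_smul, Matrix.mul_assoc]
  have scalar : (1 : Matrix κ κ ℝ) + c • 1 = (1 + c) • 1 := by rw [add_smul, one_smul]
  rw [factor, Matrix.det_one_add_mul_comm, Matrix.smul_mul, Matrix.mul_assoc,
    Matrix.nonsing_inv_mul _ hX, scalar, Matrix.det_smul, Matrix.det_one, mul_one]

/-- The residual sum of squares of the least squares fit of `y` by the columns of `X`. -/
def rss (X : Matrix ι κ ℝ) (y : ι → ℝ) : ℝ := y ⬝ᵥ ((1 - hat X) *ᵥ y)

theorem rss_eq_sub (X : Matrix ι κ ℝ) (y : ι → ℝ) :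
    rss X y = y ⬝ᵥ y - y ⬝ᵥ (hat X *ᵥ y) := by
  rw [rss, Matrix.sub_mulVec, Matrix.one_mulVec, dotProduct_sub]

theorem rss_nonneg (hX : IsUnit (Xᵀ * X).det) (y : ι → ℝ) : 0 ≤ rss X y :=
  quadraticForm_nonneg (posSemidef_of_isStarProjection (isStarProjection_hat hX).one_sub) y

theorem rss_eq_dotProduct_residual (hX : IsUnit (Xᵀ * X).det) (y : ι → ℝ) :
    rss X y = (y - hat X *ᵥ y) ⬝ᵥ (y - hat X *ᵥ y) := by
  rw [rss, dotProduct_mulVec_of_isStarProjection (isStarProjection_hat hX).one_sub,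
    Matrix.sub_mulVec, Matrix.one_mulVec]

theorem rss_sub_of_hat_mulVec (hX : IsUnit (Xᵀ * X).det) {μ : ι → ℝ} (hμ : hat X *ᵥ μ = μ)
    (y : ι → ℝ) : rss X (y - μ) = rss X y := by
  rw [rss_eq_dotProduct_residual hX, rss_eq_dotProduct_residual hX, Matrix.mulVec_sub, hμ,
    sub_sub_sub_cancel_right]

theorem rss_add (X : Matrix ι κ ℝ) (μ ε : ι → ℝ) :
    rss X (μ + ε) = rss X μ + 2 * (((1 - hat X) *ᵥ μ) ⬝ᵥ ε) + rss X ε := by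
  have symm : μ ⬝ᵥ ((1 - hat X) *ᵥ ε) = ((1 - hat X) *ᵥ μ) ⬝ᵥ ε := by
    rw [Matrix.dotProduct_mulVec, ← Matrix.mulVec_transpose, Matrix.transpose_sub,
      Matrix.transpose_one, hat_transpose]
  simp only [rss, Matrix.mulVec_add, dotProduct_add, add_dotProduct, symm]
  rw [dotProduct_comm ε ((1 - hat X) *ᵥ μ)]
  ring

end Hat

section NestedProjections

variable {ι κ κ' : Type} [Fintype ι] [Fintype κ] [DecidableEq κ] [Fintype κ'] [DecidableEq κ']
  {X : Matrix ι κ ℝ} {Y : Matrix ι κ' ℝ}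

theorem hat_mul_hat_of_nested (hYX : hat Y * X = X) : hat X * hat Y = hat X := by
  have := congrArg Matrix.transpose (hat_mul_hat hYX)
  rwa [Matrix.transpose_mul, hat_transpose, hat_transpose] at this

theorem isStarProjection_hat_sub_hat (hX : IsUnit (Xᵀ * X).det) (hY : IsUnit (Yᵀ * Y).det)
    (hYX : hat Y * X = X) : IsStarProjection (hat Y - hat X) where
  isIdempotentElem := by
    rw [IsIdempotentElem, Matrix.sub_mul, Matrix.mul_sub, Matrix.mul_sub,
      (isStarProjection_hat hX).isIdempotentElem.eq, (isStarProjection_hat hY).isIdempotentElem.eq,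
      hat_mul_hat hYX, hat_mul_hat_of_nested hYX, sub_self, sub_zero]
  isSelfAdjoint := (isStarProjection_hat hY).isSelfAdjoint.sub
    (isStarProjection_hat hX).isSelfAdjoint

variable [DecidableEq ι]

theorem rss_eq_rss_add (X : Matrix ι κ ℝ) (Y : Matrix ι κ' ℝ) (y : ι → ℝ) :
    rss X y = rss Y y + y ⬝ᵥ ((hat Y - hat X) *ᵥ y) := by
  rw [rss_eq_sub, rss_eq_sub, Matrix.sub_mulVec, dotProduct_sub, sub_add_sub_cancel]

/-- The quadratic form with coefficients `b₀`, `b₁`, `b₂` on the column space of `X`, its complement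
in the column space of `Y`, and the complement of the latter, provided that `X` and `Y` have
linearly independent columns and nested column spaces. -/
def nestedForm (X : Matrix ι κ ℝ) (Y : Matrix ι κ' ℝ) (b₀ b₁ b₂ : ℝ) : Matrix ι ι ℝ :=
  b₀ • hat X + b₁ • (hat Y - hat X) + b₂ • (1 - hat Y)

theorem one_sub_nestedForm (X : Matrix ι κ ℝ) (Y : Matrix ι κ' ℝ) (b₀ b₁ b₂ : ℝ) :
    1 - nestedForm X Y b₀ b₁ b₂ = nestedForm X Y (1 - b₀) (1 - b₁) (1 - b₂) := by
  simp only [nestedForm]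
  module

theorem quadraticForm_nestedForm (X : Matrix ι κ ℝ) (Y : Matrix ι κ' ℝ) (b₀ b₁ b₂ : ℝ)
    (x : ι → ℝ) :
    x ⬝ᵥ (nestedForm X Y b₀ b₁ b₂ *ᵥ x) = b₀ * (x ⬝ᵥ (hat X *ᵥ x)) +
      b₁ * (x ⬝ᵥ ((hat Y - hat X) *ᵥ x)) + b₂ * rss Y x := by
  simp only [nestedForm, Matrix.add_mulVec, Matrix.smul_mulVec, dotProduct_add, dotProduct_smul,
    smul_eq_mul, rss]

theorem posSemidef_nestedForm (hX : IsUnit (Xᵀ * X).det) (hY : IsUnit (Yᵀ * Y).det)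
    (hYX : hat Y * X = X) {b₀ b₁ b₂ : ℝ} (h₀ : 0 ≤ b₀) (h₁ : 0 ≤ b₁) (h₂ : 0 ≤ b₂) :
    (nestedForm X Y b₀ b₁ b₂).PosSemidef :=
  (((posSemidef_of_isStarProjection (isStarProjection_hat hX)).smul h₀).add
    ((posSemidef_of_isStarProjection (isStarProjection_hat_sub_hat hX hY hYX)).smul h₁)).add
    ((posSemidef_of_isStarProjection (isStarProjection_hat hY).one_sub).smul h₂)

theorem posDef_nestedForm (hX : IsUnit (Xᵀ * X).det) (hY : IsUnit (Yᵀ * Y).det)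
    (hYX : hat Y * X = X) {b₀ b₁ b₂ : ℝ} (h₀ : 0 < b₀) (h₁ : 0 < b₁) (h₂ : 0 < b₂) :
    (nestedForm X Y b₀ b₁ b₂).PosDef := by
  obtain ⟨c, hc, hc₀, hc₁, hc₂⟩ : ∃ c > 0, c ≤ b₀ ∧ c ≤ b₁ ∧ c ≤ b₂ :=
    ⟨min b₀ (min b₁ b₂), by positivity, by simp, by simp, by simp⟩
  have split : nestedForm X Y b₀ b₁ b₂ = c • 1 + nestedForm X Y (b₀ - c) (b₁ - c) (b₂ - c) := by
    simp only [nestedForm]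
    module
  rw [split]
  exact (Matrix.PosDef.one.smul hc).add_posSemidef
    (posSemidef_nestedForm hX hY hYX (sub_nonneg.2 hc₀) (sub_nonneg.2 hc₁) (sub_nonneg.2 hc₂))

theorem det_nestedForm (hX : IsUnit (Xᵀ * X).det) (hY : IsUnit (Yᵀ * Y).det)
    (hYX : hat Y * X = X) {b₀ b₁ b₂ : ℝ} (h₀ : 0 < b₀) (h₁ : 0 < b₁) (h₂ : 0 < b₂) :
    (nestedForm X Y b₀ b₁ b₂).det = b₀ ^ (Fintype.card κ : ℝ) *
      b₁ ^ ((Fintype.card κ' : ℝ) - Fintype.card κ) *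
      b₂ ^ ((Fintype.card ι : ℝ) - Fintype.card κ') := by
  have factor : nestedForm X Y b₀ b₁ b₂ =
      (1 + (b₀ / b₁ - 1) • hat X) * (b₂ • (1 + (b₁ / b₂ - 1) • hat Y)) := by
    simp only [Matrix.mul_smul, Matrix.add_mul, Matrix.one_mul, Matrix.mul_add, Matrix.mul_one,
      Matrix.smul_mul, hat_mul_hat_of_nested hYX, smul_add, smul_smul, nestedForm]
    match_scalars <;> field_simp <;> ring
  rw [factor, Matrix.det_mul, Matrix.det_smul, det_one_add_smul_hat hX, det_one_add_smul_hat hY,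
    add_sub_cancel, add_sub_cancel, Real.rpow_sub h₁, Real.rpow_sub h₂]
  simp only [Real.rpow_natCast, div_pow]
  field_simp

theorem lintegral_exp_nestedForm (hX : IsUnit (Xᵀ * X).det) (hY : IsUnit (Yᵀ * Y).det)
    (hYX : hat Y * X = X) {b₀ b₁ b₂ : ℝ} (h₀ : b₀ < 1) (h₁ : b₁ < 1) (h₂ : b₂ < 1) (μ : ι → ℝ)
    {φ : ℝ} (hφ : 0 < φ) :
    ∫⁻ y, ENNReal.ofReal (Real.exp (((y - μ) ⬝ᵥ (nestedForm X Y b₀ b₁ b₂ *ᵥ (y - μ))) / (2 * φ)))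
        ∂(isotropicGaussian μ φ) =
      ENNReal.ofReal ((1 - b₀) ^ (-(Fintype.card κ / 2 : ℝ)) *
        (1 - b₁) ^ (-((Fintype.card κ' - Fintype.card κ) / 2 : ℝ)) *
        (1 - b₂) ^ (-((Fintype.card ι - Fintype.card κ') / 2 : ℝ))) := by
  rw [← sub_pos] at h₀ h₁ h₂
  have inv_sqrt_rpow : ∀ {b : ℝ} (q : ℝ), 0 < b → (√(b ^ q))⁻¹ = b ^ (-(q / 2)) := fun q hb => by
    rw [Real.rpow_neg hb.le, Real.rpow_div_two_eq_sqrt _ hb.le, Real.sqrt_eq_rpow,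
      Real.sqrt_eq_rpow, ← Real.rpow_mul hb.le, ← Real.rpow_mul hb.le, mul_comm]
  have hdet := det_nestedForm hX hY hYX h₀ h₁ h₂
  rw [lintegral_exp_quadraticForm μ hφ
    (by rw [one_sub_nestedForm]; exact posDef_nestedForm hX hY hYX h₀ h₁ h₂), one_sub_nestedForm,
    hdet, Real.sqrt_mul (by positivity), Real.sqrt_mul (by positivity), mul_inv, mul_inv,
    inv_sqrt_rpow _ h₀, inv_sqrt_rpow _ h₁, inv_sqrt_rpow _ h₂]

omit [DecidableEq ι] in
theorem lintegral_exp_hat (hX : IsUnit (Xᵀ * X).det) {b : ℝ} (hb : b < 1) (μ : ι → ℝ)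
    {φ : ℝ} (hφ : 0 < φ) :
    ∫⁻ y, ENNReal.ofReal (Real.exp (b * ((y - μ) ⬝ᵥ (hat X *ᵥ (y - μ))) / (2 * φ)))
        ∂(isotropicGaussian μ φ) =
      ENNReal.ofReal ((1 - b) ^ (-(Fintype.card κ / 2 : ℝ))) := by
  classical
  simpa only [quadraticForm_nestedForm, zero_mul, add_zero, sub_zero, Real.one_rpow, mul_one] using
    lintegral_exp_nestedForm hX hX (hat_mul_self hX) hb zero_lt_one zero_lt_one μ hφ

theorem lintegral_exp_rss (hX : IsUnit (Xᵀ * X).det) {b : ℝ} (hb : b < 1) (μ : ι → ℝ)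
    {φ : ℝ} (hφ : 0 < φ) :
    ∫⁻ y, ENNReal.ofReal (Real.exp (b * rss X (y - μ) / (2 * φ))) ∂(isotropicGaussian μ φ) =
      ENNReal.ofReal ((1 - b) ^ (-((Fintype.card ι - Fintype.card κ) / 2 : ℝ))) := by
  simpa only [quadraticForm_nestedForm, zero_mul, zero_add, sub_zero, Real.one_rpow, one_mul] using
    lintegral_exp_nestedForm hX hX (hat_mul_self hX) zero_lt_one zero_lt_one hb μ hφ

end NestedProjections

section Chernoff

theorem measure_le_exp_neg_mul_lintegral_exp {Ω : Type*} [MeasurableSpace Ω] (μ : Measure Ω)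
    {f : Ω → ℝ} (hf : Measurable f) (x : ℝ) :
    μ {ω | x ≤ f ω} ≤
      ENNReal.ofReal (Real.exp (-x)) * ∫⁻ ω, ENNReal.ofReal (Real.exp (f ω)) ∂μ := by
  have markov := meas_ge_le_lintegral_div (μ := μ) hf.exp.ennreal_ofReal.aemeasurable
    (ENNReal.ofReal_pos.2 (Real.exp_pos x)).ne' ENNReal.ofReal_ne_top
  rw [div_eq_mul_inv, mul_comm, ← ENNReal.ofReal_inv_of_pos (Real.exp_pos x), ← Real.exp_neg]
    at markov
  refine (measure_mono fun ω hω => ?_).trans markov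
  exact ENNReal.ofReal_le_ofReal (Real.exp_le_exp.2 hω)

variable {ι κ : Type} [Fintype ι] [Fintype κ] [DecidableEq κ] {X : Matrix ι κ ℝ}

theorem measure_le_quadraticForm_hat (hX : IsUnit (Xᵀ * X).det) (μ : ι → ℝ) {φ : ℝ} (hφ : 0 < φ)
    (x : ℝ) :
    isotropicGaussian μ φ {y | x ≤ (y - μ) ⬝ᵥ (hat X *ᵥ (y - μ))} ≤
      ENNReal.ofReal (Real.exp (Fintype.card κ / 2 - x / (4 * φ))) := by
  have two_le_exp : (1 - 1 / 2 : ℝ) ^ (-(Fintype.card κ / 2 : ℝ)) ≤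
      Real.exp (Fintype.card κ / 2) := by
    rw [show (1 - 1 / 2 : ℝ) = 2⁻¹ by norm_num, Real.inv_rpow zero_le_two,
      Real.rpow_neg zero_le_two, inv_inv, ← Real.exp_one_rpow]
    have := Real.add_one_le_exp 1
    exact Real.rpow_le_rpow zero_le_two (by linarith) (by positivity)
  have hmeas : Measurable fun y : ι → ℝ =>
      1 / 2 * ((y - μ) ⬝ᵥ (hat X *ᵥ (y - μ))) / (2 * φ) := by
    simp only [dotProduct, Matrix.mulVec, Pi.sub_apply]
    fun_prop
  have chernoff := measure_le_exp_neg_mul_lintegral_exp (isotropicGaussian μ φ) hmeas (x / (4 * φ))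
  rw [lintegral_exp_hat hX (by norm_num) μ hφ, ← ENNReal.ofReal_mul (by positivity)] at chernoff
  refine (measure_mono fun y hy => ?_).trans (chernoff.trans (ENNReal.ofReal_le_ofReal ?_))
  · calc x / (4 * φ) ≤ ((y - μ) ⬝ᵥ (hat X *ᵥ (y - μ))) / (4 * φ) := by
          gcongr
          exact hy
      _ = _ := by ring
  · rw [sub_eq_neg_add (Fintype.card κ / 2 : ℝ), Real.exp_add]
    gcongr

theorem measure_le_dotProduct_self (μ : ι → ℝ) {φ : ℝ} (hφ : 0 < φ) (x : ℝ) :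
    isotropicGaussian μ φ {y | x ≤ (y - μ) ⬝ᵥ (y - μ)} ≤
      ENNReal.ofReal (Real.exp (Fintype.card ι / 2 - x / (4 * φ))) := by
  classical
  simpa only [hat_one, Matrix.one_mulVec] using
    measure_le_quadraticForm_hat (X := (1 : Matrix ι ι ℝ)) (by simp) μ hφ x

theorem measure_dotProduct_le_neg (μ v : ι → ℝ) {φ x : ℝ} (hφ : 0 < φ) (hx : 0 ≤ x) :
    isotropicGaussian μ φ {y | v ⬝ᵥ (y - μ) ≤ -x} ≤
      ENNReal.ofReal (Real.exp (-(x ^ 2 / (2 * φ * (v ⬝ᵥ v))))) := by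
  set s := x / (φ * (v ⬝ᵥ v)) with hs
  have hv : 0 ≤ v ⬝ᵥ v := dotProduct_self_nonneg_real v
  have hmeas : Measurable fun y : ι → ℝ => (-s • v) ⬝ᵥ (y - μ) := by
    simp only [dotProduct, Pi.sub_apply]
    fun_prop
  have chernoff := measure_le_exp_neg_mul_lintegral_exp (isotropicGaussian μ φ) hmeas (s * x)
  rw [lintegral_exp_dotProduct μ _ hφ, ← ENNReal.ofReal_mul (by positivity), ← Real.exp_add]
    at chernoff
  refine (measure_mono fun y hy => ?_).trans (chernoff.trans_eq ?_)
  · have hs0 : 0 ≤ s := by positivity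
    simp only [mem_ofPred_eq, smul_dotProduct, smul_eq_mul] at hy ⊢
    nlinarith
  · congr 2
    rw [smul_dotProduct, dotProduct_smul, smul_eq_mul, smul_eq_mul, hs]
    rcases hv.eq_or_lt' with h0 | h0
    · simp [h0]
    · field_simp
      ring

theorem measure_rss_le [DecidableEq ι] (hX : IsUnit (Xᵀ * X).det) (μ : ι → ℝ) {φ e : ℝ}
    (hφ : 0 < φ) (he : 0 < e) (he1 : e ≤ 1) :
    isotropicGaussian μ φ {y | rss X (y - μ) ≤ e * Fintype.card ι * φ} ≤
      ENNReal.ofReal (Real.exp (Fintype.card ι / 2) *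
        e ^ ((Fintype.card ι - Fintype.card κ) / 2 : ℝ)) := by
  have hmeas : Measurable fun y : ι → ℝ => (1 - e⁻¹) * rss X (y - μ) / (2 * φ) := by
    simp only [rss, dotProduct, Matrix.mulVec, Pi.sub_apply]
    fun_prop
  have chernoff := measure_le_exp_neg_mul_lintegral_exp (isotropicGaussian μ φ) hmeas
    (-((1 - e) * Fintype.card ι / 2))
  rw [lintegral_exp_rss hX (by simpa using he) μ hφ, ← ENNReal.ofReal_mul (by positivity),
    sub_sub_cancel, Real.inv_rpow he.le, Real.rpow_neg he.le, inv_inv, neg_neg] at chernoff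
  refine (measure_mono fun y hy => ?_).trans (chernoff.trans (ENNReal.ofReal_le_ofReal ?_))
  · have hcoef : 1 - e⁻¹ ≤ 0 := sub_nonpos.2 (one_le_inv₀ he |>.2 he1)
    calc -((1 - e) * Fintype.card ι / 2) = (1 - e⁻¹) * (e * Fintype.card ι * φ) / (2 * φ) := by
          field_simp
          ring
      _ ≤ (1 - e⁻¹) * rss X (y - μ) / (2 * φ) :=
          div_le_div_of_nonneg_right (mul_le_mul_of_nonpos_left hy hcoef) (by positivity)
  · gcongr
    nlinarith [Nat.cast_nonneg (α := ℝ) (Fintype.card ι)]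

end Chernoff

section Ridge

theorem sqrt_pow_of_nonneg {x : ℝ} (hx : 0 ≤ x) (k : ℕ) : √(x ^ k) = √x ^ k := by
  rw [Real.sqrt_eq_iff_eq_sq (by positivity) (by positivity), pow_right_comm, Real.sq_sqrt hx]

variable {ι κ : Type} [Fintype ι] [Fintype κ] [DecidableEq κ] {X : Matrix ι κ ℝ} {V : Matrix κ κ ℝ}
  {τ : ℝ}

/-- The penalized residual sum of squares of ridge regression. Given the variance `φ`, minus the
logarithm of the joint density of data `y` and coefficients `θ` is this divided by `2 φ`, up to a
constant. -/
def penalizedRss (X : Matrix ι κ ℝ) (V : Matrix κ κ ℝ) (τ : ℝ) (y : ι → ℝ) (θ : κ → ℝ) : ℝ :=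
  (y - X *ᵥ θ) ⬝ᵥ (y - X *ᵥ θ) + τ⁻¹ * (θ ⬝ᵥ (V⁻¹ *ᵥ θ))

/-- The posterior precision matrix of the coefficients, up to the factor `φ⁻¹`. -/
def ridgeMatrix (X : Matrix ι κ ℝ) (V : Matrix κ κ ℝ) (τ : ℝ) : Matrix κ κ ℝ :=
  Xᵀ * X + τ⁻¹ • V⁻¹

/-- The ridge estimator of the coefficients, which minimizes `penalizedRss`. -/
def ridgeEstimator (X : Matrix ι κ ℝ) (V : Matrix κ κ ℝ) (τ : ℝ) (y : ι → ℝ) : κ → ℝ :=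
  (ridgeMatrix X V τ)⁻¹ *ᵥ (Xᵀ *ᵥ y)

/-- The minimum of `penalizedRss` over the coefficients. -/
def ridgeRss (X : Matrix ι κ ℝ) (V : Matrix κ κ ℝ) (τ : ℝ) (y : ι → ℝ) : ℝ :=
  penalizedRss X V τ y (ridgeEstimator X V τ y)

theorem penalizedRss_add (hV : V.IsHermitian) (y : ι → ℝ) (θ h : κ → ℝ) :
    penalizedRss X V τ y (θ + h) = penalizedRss X V τ y θ + h ⬝ᵥ (ridgeMatrix X V τ *ᵥ h) +
      2 * (h ⬝ᵥ (ridgeMatrix X V τ *ᵥ θ - Xᵀ *ᵥ y)) := by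
  have hVT : V⁻¹ᵀ = V⁻¹ := hV.inv
  have symm : θ ⬝ᵥ (V⁻¹ *ᵥ h) = h ⬝ᵥ (V⁻¹ *ᵥ θ) := by
    rw [Matrix.dotProduct_mulVec, ← Matrix.mulVec_transpose, hVT, dotProduct_comm]
  have adjoint (u : κ → ℝ) (w : ι → ℝ) : u ⬝ᵥ (Xᵀ *ᵥ w) = (X *ᵥ u) ⬝ᵥ w := by
    rw [Matrix.dotProduct_mulVec, Matrix.vecMul_transpose]
  simp only [penalizedRss, ridgeMatrix, Matrix.mulVec_add, Matrix.add_mulVec, Matrix.smul_mulVec,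
    dotProduct_add, add_dotProduct, dotProduct_sub, sub_dotProduct, dotProduct_smul, smul_eq_mul,
    ← Matrix.mulVec_mulVec, symm, adjoint]
  rw [dotProduct_comm y (X *ᵥ h), dotProduct_comm (X *ᵥ θ) (X *ᵥ h)]
  ring

theorem posDef_ridgeMatrix (X : Matrix ι κ ℝ) (hV : V.PosDef) (hτ : 0 < τ) :
    (ridgeMatrix X V τ).PosDef := by
  have gram := Matrix.posSemidef_conjTranspose_mul_self X
  rw [Matrix.conjTranspose_eq_transpose_of_trivial] at gram
  exact Matrix.PosDef.posSemidef_add gram (hV.inv.smul (inv_pos.2 hτ))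

theorem penalizedRss_eq (X : Matrix ι κ ℝ) (hV : V.PosDef) (hτ : 0 < τ) (y : ι → ℝ) (θ : κ → ℝ) :
    penalizedRss X V τ y θ = ridgeRss X V τ y +
      (θ - ridgeEstimator X V τ y) ⬝ᵥ (ridgeMatrix X V τ *ᵥ (θ - ridgeEstimator X V τ y)) := by
  have normal_equation : ridgeMatrix X V τ *ᵥ ridgeEstimator X V τ y = Xᵀ *ᵥ y := by
    rw [ridgeEstimator, Matrix.mulVec_mulVec, Matrix.mul_nonsing_inv _
      ((Matrix.isUnit_iff_isUnit_det _).1 (posDef_ridgeMatrix X hV hτ).isUnit), Matrix.one_mulVec]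
  have := penalizedRss_add (X := X) (τ := τ) hV.isHermitian y (ridgeEstimator X V τ y)
    (θ - ridgeEstimator X V τ y)
  rwa [add_sub_cancel, normal_equation, sub_self, dotProduct_zero, mul_zero, add_zero] at this

theorem ridgeRss_le_penalizedRss (X : Matrix ι κ ℝ) (hV : V.PosDef) (hτ : 0 < τ) (y : ι → ℝ)
    (θ : κ → ℝ) : ridgeRss X V τ y ≤ penalizedRss X V τ y θ := by
  rw [penalizedRss_eq X hV hτ]
  exact le_add_of_nonneg_right (quadraticForm_nonneg (posDef_ridgeMatrix X hV hτ).posSemidef _)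

theorem det_ridgeMatrix (X : Matrix ι κ ℝ) (hV : V.PosDef) (hτ : τ ≠ 0) :
    τ ^ Fintype.card κ * V.det * (ridgeMatrix X V τ).det = (1 + τ • (V * (Xᵀ * X))).det := by
  rw [← Matrix.det_smul, ← Matrix.det_mul, ridgeMatrix, Matrix.mul_add, Matrix.smul_mul,
    Matrix.smul_mul, Matrix.mul_smul,
    Matrix.mul_nonsing_inv _ ((Matrix.isUnit_iff_isUnit_det _).1 hV.isUnit), smul_smul,
    mul_inv_cancel₀ hτ, one_smul, add_comm]

theorem normalPdf_smul (hV : V.PosDef) {c : ℝ} (hc : 0 < c) (μ x : κ → ℝ) :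
    normalPdf μ (c • V) x = (√(2 * Real.pi * c) ^ Fintype.card κ * √V.det)⁻¹ *
      Real.exp (-((x - μ) ⬝ᵥ (V⁻¹ *ᵥ (x - μ))) / (2 * c)) := by
  have hinv : (c • V)⁻¹ = c⁻¹ • V⁻¹ :=
    Matrix.inv_smul' (A := V) (Units.mk0 c hc.ne') ((Matrix.isUnit_iff_isUnit_det _).1 hV.isUnit)
  rw [normalPdf, hinv, Matrix.det_smul, ← mul_assoc, ← mul_pow, Real.sqrt_mul (by positivity),
    Matrix.smul_mulVec, dotProduct_smul, smul_eq_mul,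
    sqrt_pow_of_nonneg (by positivity)]
  congr 2
  field_simp

theorem normalPdf_mul_normalPdf [DecidableEq ι] (X : Matrix ι κ ℝ) (hV : V.PosDef) (hτ : 0 < τ)
    {φ : ℝ} (hφ : 0 < φ) (y : ι → ℝ) (θ : κ → ℝ) :
    normalPdf (X *ᵥ θ) (φ • (1 : Matrix ι ι ℝ)) y * normalPdf 0 ((τ * φ) • V) θ =
      (√(2 * Real.pi * φ) ^ Fintype.card ι)⁻¹ *
        (√(2 * Real.pi * (τ * φ)) ^ Fintype.card κ * √V.det)⁻¹ *
        Real.exp (-ridgeRss X V τ y / (2 * φ)) *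
        Real.exp (-((θ - ridgeEstimator X V τ y) ⬝ᵥ
          (ridgeMatrix X V τ *ᵥ (θ - ridgeEstimator X V τ y))) / (2 * φ)) := by
  have exponent : -((y - X *ᵥ θ) ⬝ᵥ (y - X *ᵥ θ)) / (2 * φ) +
      -(θ ⬝ᵥ (V⁻¹ *ᵥ θ)) / (2 * (τ * φ)) = -ridgeRss X V τ y / (2 * φ) +
        -((θ - ridgeEstimator X V τ y) ⬝ᵥ
          (ridgeMatrix X V τ *ᵥ (θ - ridgeEstimator X V τ y))) / (2 * φ) := by
    have complete_square := penalizedRss_eq X hV hτ y θ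
    rw [penalizedRss] at complete_square
    rw [eq_sub_of_add_eq' complete_square.symm]
    field_simp
    ring
  rw [mul_assoc _ (Real.exp _) (Real.exp _), ← Real.exp_add, ← exponent, Real.exp_add,
    normalPdf_smul Matrix.PosDef.one hφ, normalPdf_smul hV (by positivity), inv_one,
    Matrix.one_mulVec, sub_zero, Matrix.det_one, Real.sqrt_one, mul_one]
  ring

theorem lintegral_normalPdf_mul_normalPdf [DecidableEq ι] (X : Matrix ι κ ℝ) (hV : V.PosDef)
    (hτ : 0 < τ) {φ : ℝ} (hφ : 0 < φ) (y : ι → ℝ) :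
    ∫⁻ θ : κ → ℝ, ENNReal.ofReal (normalPdf (X *ᵥ θ) (φ • (1 : Matrix ι ι ℝ)) y *
        normalPdf 0 ((τ * φ) • V) θ) =
      ENNReal.ofReal ((√(2 * Real.pi * φ) ^ Fintype.card ι)⁻¹ *
        (√(1 + τ • (V * (Xᵀ * X))).det)⁻¹ * Real.exp (-ridgeRss X V τ y / (2 * φ))) := by
  have hA := posDef_ridgeMatrix X hV hτ
  have hdet := hA.det_pos
  have hVdet := hV.det_pos
  have hconst : 0 ≤ (√(2 * Real.pi * φ) ^ Fintype.card ι)⁻¹ *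
      (√(2 * Real.pi * (τ * φ)) ^ Fintype.card κ * √V.det)⁻¹ *
      Real.exp (-ridgeRss X V τ y / (2 * φ)) := by positivity
  simp only [normalPdf_mul_normalPdf X hV hτ hφ y, ENNReal.ofReal_mul hconst]
  rw [lintegral_const_mul, lintegral_sub_right_eq_self (fun θ : κ → ℝ =>
      ENNReal.ofReal (Real.exp (-(θ ⬝ᵥ (ridgeMatrix X V τ *ᵥ θ)) / (2 * φ)))),
    lintegral_exp_neg_posDef hA hφ, ← ENNReal.ofReal_mul (by positivity)]
  · congr 1
    rw [← det_ridgeMatrix X hV hτ.ne', Real.sqrt_mul (by positivity) (ridgeMatrix X V τ).det,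
      Real.sqrt_mul (by positivity) V.det, sqrt_pow_of_nonneg hτ.le,
      show 2 * Real.pi * (τ * φ) = 2 * Real.pi * φ * τ by ring,
      Real.sqrt_mul (by positivity) τ, mul_pow]
    field_simp
  · simp only [dotProduct, Matrix.mulVec, Pi.sub_apply]
    fun_prop

variable [DecidableEq ι]

theorem rss_le_penalizedRss (hX : IsUnit (Xᵀ * X).det) (hV : V.PosDef) (hτ : 0 < τ) (y : ι → ℝ)
    (θ : κ → ℝ) : rss X y ≤ penalizedRss X V τ y θ := by
  have residual := quadraticForm_le_of_isStarProjection (isStarProjection_hat hX).one_sub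
    (y - X *ᵥ θ)
  have penalty := quadraticForm_nonneg hV.inv.posSemidef θ
  rw [← rss_sub_of_hat_mulVec hX (hat_mulVec_mulVec hX θ)]
  exact residual.trans (le_add_of_nonneg_right (by positivity))

theorem rss_le_ridgeRss (hX : IsUnit (Xᵀ * X).det) (hV : V.PosDef) (hτ : 0 < τ) (y : ι → ℝ) :
    rss X y ≤ ridgeRss X V τ y :=
  rss_le_penalizedRss hX hV hτ _ _

theorem ridgeRss_le (hX : IsUnit (Xᵀ * X).det) (hV : V.PosDef) (hτ : 0 < τ) {ρ : ℝ} (hρ : 0 < ρ)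
    (h : ∀ θ : κ → ℝ, ρ * (θ ⬝ᵥ (V⁻¹ *ᵥ θ)) ≤ θ ⬝ᵥ ((Xᵀ * X) *ᵥ θ)) (y : ι → ℝ) :
    ridgeRss X V τ y ≤ rss X y + (y ⬝ᵥ (hat X *ᵥ y)) / (τ * ρ) := by
  set θ := (Xᵀ * X)⁻¹ *ᵥ (Xᵀ *ᵥ y) with hθ
  have fitted : X *ᵥ θ = hat X *ᵥ y := by
    rw [hθ, Matrix.mulVec_mulVec, Matrix.mulVec_mulVec, hat]
  have explained : θ ⬝ᵥ ((Xᵀ * X) *ᵥ θ) = y ⬝ᵥ (hat X *ᵥ y) := by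
    rw [dotProduct_mulVec_of_isStarProjection (isStarProjection_hat hX), ← fitted,
      ← Matrix.mulVec_mulVec, Matrix.dotProduct_mulVec, Matrix.vecMul_transpose]
  have penalty : τ⁻¹ * (θ ⬝ᵥ (V⁻¹ *ᵥ θ)) ≤ (y ⬝ᵥ (hat X *ᵥ y)) / (τ * ρ) := by
    rw [inv_mul_eq_div, div_le_div_iff₀ hτ (by positivity), ← explained]
    calc θ ⬝ᵥ (V⁻¹ *ᵥ θ) * (τ * ρ) = τ * (ρ * (θ ⬝ᵥ (V⁻¹ *ᵥ θ))) := by ring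
      _ ≤ τ * (θ ⬝ᵥ ((Xᵀ * X) *ᵥ θ)) := by gcongr; exact h θ
      _ = _ := mul_comm _ _
  calc ridgeRss X V τ y ≤ penalizedRss X V τ y θ := ridgeRss_le_penalizedRss X hV hτ y θ
    _ ≤ _ := by
      rw [penalizedRss, fitted, ← rss_eq_dotProduct_residual hX]
      gcongr

theorem ridgeRss_of_isEmpty [IsEmpty κ] (X : Matrix ι κ ℝ) (V : Matrix κ κ ℝ) (τ : ℝ) (y : ι → ℝ) :
    ridgeRss X V τ y = rss X y := by
  simp [ridgeRss, penalizedRss, rss, hat, dotProduct, Matrix.mulVec, Matrix.mul_apply,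
    Matrix.sub_apply, Matrix.one_apply]

end Ridge

section Eigenvalues

variable {κ : Type} [Fintype κ] [DecidableEq κ]

theorem le_quadraticForm_of_le_roots_charpoly {M : Matrix κ κ ℝ} (hM : M.IsHermitian) {ρ : ℝ}
    (hρ : ∀ x ∈ M.charpoly.roots, ρ ≤ x) (x : κ → ℝ) : ρ * (x ⬝ᵥ x) ≤ x ⬝ᵥ (M *ᵥ x) := by
  have shifted : (M - algebraMap ℝ (Matrix κ κ ℝ) ρ).PosSemidef := by
    rw [Matrix.posSemidef_iff_isHermitian_and_spectrum_nonneg, ← spectrum.sub_singleton_eq]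
    refine ⟨hM.sub (by simp [Matrix.IsHermitian, Algebra.algebraMap_eq_smul_one]), ?_⟩
    rintro _ ⟨z, hz, w, rfl, rfl⟩
    rw [Matrix.mem_spectrum_iff_isRoot_charpoly] at hz
    simpa using hρ z ((Polynomial.mem_roots (Matrix.charpoly_monic M).ne_zero).2 hz)
  have := quadraticForm_nonneg shifted x
  rwa [Algebra.algebraMap_eq_smul_one, Matrix.sub_mulVec, Matrix.smul_mulVec, Matrix.one_mulVec,
    dotProduct_sub, dotProduct_smul, smul_eq_mul, sub_nonneg] at this

theorem det_one_add_smul_eq_prod_roots {M : Matrix κ κ ℝ} (hM : M.IsHermitian) (τ : ℝ) :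
    (1 + τ • M).det = (M.charpoly.roots.map fun x => τ * x + 1).prod := by
  rcases eq_or_ne τ 0 with rfl | hτ
  · simp
  have scalar : 1 + τ • M = (-τ) • (Matrix.scalar κ (-τ⁻¹) - M) := by
    rw [smul_sub, Matrix.scalar_apply, ← Matrix.smul_one_eq_diagonal, smul_smul, neg_mul_neg,
      mul_inv_cancel₀ hτ, one_smul, neg_smul, sub_neg_eq_add]
  rw [scalar, Matrix.det_smul, ← Matrix.eval_charpoly, hM.roots_charpoly_eq_eigenvalues,
    hM.charpoly_eq, Polynomial.eval_prod, ← Finset.card_univ, ← Finset.prod_const,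
    ← Finset.prod_mul_distrib, Multiset.map_map]
  refine Finset.prod_congr rfl fun i _ => ?_
  simp only [Polynomial.eval_sub, Polynomial.eval_X, Polynomial.eval_C, Function.comp_apply]
  field_simp
  simp

variable {V G : Matrix κ κ ℝ}

theorem exists_posDef_charpoly_mul_eq (hV : V.PosDef) (hG : G.PosDef) :
    ∃ B : Matrix κ κ ℝ, IsUnit B.det ∧ V = Bᵀ * B ∧ (B * G * Bᵀ).PosDef ∧
      (V * G).charpoly = (B * G * Bᵀ).charpoly := by
  obtain ⟨B, hB, rfl⟩ := exists_eq_transpose_mul_self_of_posDef hV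
  refine ⟨B, hB.isUnit, rfl, ?_, ?_⟩
  · have := hG.mul_mul_conjTranspose_same (B := B)
      (Matrix.vecMul_injective_iff_isUnit.2 ((Matrix.isUnit_iff_isUnit_det _).2 hB.isUnit))
    rwa [Matrix.conjTranspose_eq_transpose_of_trivial] at this
  · rw [Matrix.mul_assoc, Matrix.charpoly_mul_comm]

theorem pos_of_mem_roots_charpoly_mul (hV : V.PosDef) (hG : G.PosDef) :
    ∀ x ∈ (V * G).charpoly.roots, 0 < x := by
  obtain ⟨B, -, -, hM, hc⟩ := exists_posDef_charpoly_mul_eq hV hG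
  rw [hc, hM.isHermitian.roots_charpoly_eq_eigenvalues]
  intro x hx
  obtain ⟨i, -, rfl⟩ := Multiset.mem_map.1 hx
  exact hM.eigenvalues_pos i

theorem card_roots_charpoly_mul (hV : V.PosDef) (hG : G.PosDef) :
    (V * G).charpoly.roots.card = Fintype.card κ := by
  obtain ⟨B, -, -, hM, hc⟩ := exists_posDef_charpoly_mul_eq hV hG
  simp [hc, hM.isHermitian.roots_charpoly_eq_eigenvalues]

theorem det_one_add_smul_mul_eq_prod_roots (hV : V.PosDef) (hG : G.PosDef) (τ : ℝ) :
    (1 + τ • (V * G)).det = ((V * G).charpoly.roots.map fun x => τ * x + 1).prod := by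
  obtain ⟨B, -, hVB, hM, hc⟩ := exists_posDef_charpoly_mul_eq hV hG
  rw [hc, ← det_one_add_smul_eq_prod_roots hM.isHermitian, hVB, ← Matrix.mul_smul,
    Matrix.mul_assoc, Matrix.det_one_add_mul_comm, Matrix.mul_smul, Matrix.smul_mul]

theorem le_quadraticForm_of_le_roots_charpoly_mul (hV : V.PosDef) (hG : G.PosDef) {ρ : ℝ}
    (hρ : ∀ x ∈ (V * G).charpoly.roots, ρ ≤ x) (θ : κ → ℝ) :
    ρ * (θ ⬝ᵥ (V⁻¹ *ᵥ θ)) ≤ θ ⬝ᵥ (G *ᵥ θ) := by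
  obtain ⟨B, hB, hVB, hM, hc⟩ := exists_posDef_charpoly_mul_eq hV hG
  have hBT : IsUnit Bᵀ.det := by rwa [Matrix.det_transpose]
  obtain ⟨x, rfl⟩ : ∃ x, θ = Bᵀ *ᵥ x :=
    ⟨Bᵀ⁻¹ *ᵥ θ, by rw [Matrix.mulVec_mulVec, Matrix.mul_nonsing_inv _ hBT, Matrix.one_mulVec]⟩
  have congruence (A : Matrix κ κ ℝ) :
      (Bᵀ *ᵥ x) ⬝ᵥ (A *ᵥ (Bᵀ *ᵥ x)) = x ⬝ᵥ ((B * A * Bᵀ) *ᵥ x) := by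
    rw [Matrix.mulVec_transpose B x, ← Matrix.dotProduct_mulVec, ← Matrix.mulVec_transpose,
      Matrix.mulVec_mulVec, Matrix.mulVec_mulVec, Matrix.mul_assoc]
  have whitened : B * V⁻¹ * Bᵀ = 1 := by
    rw [hVB, Matrix.mul_inv_rev, Matrix.mul_nonsing_inv_cancel_left _ _ hB,
      Matrix.nonsing_inv_mul _ hBT]
  rw [congruence, congruence, whitened, Matrix.one_mulVec]
  exact le_quadraticForm_of_le_roots_charpoly hM.isHermitian (hc ▸ hρ) x

end Eigenvalues

section InverseGamma

/-- The integral over `x` of the unnormalized density of the inverse gamma distribution with shape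
`N / 2` and scale `s / 2`. -/
def invGammaIntegral (N s : ℝ) : ℝ≥0∞ :=
  ∫⁻ x in Ioi (0 : ℝ), ENNReal.ofReal (x ^ (-(N / 2 + 1)) * Real.exp (-s / (2 * x)))

theorem invGammaIntegral_eq_rpow_mul (N : ℝ) {s : ℝ} (hs : 0 < s) :
    invGammaIntegral N s = ENNReal.ofReal (s ^ (-(N / 2))) * invGammaIntegral N 1 := by
  have image_Ioi : (fun x : ℝ => s * x) '' Ioi 0 = Ioi 0 := by
    rw [image_mul_left_Ioi hs, mul_zero]
  rw [invGammaIntegral, ← image_Ioi, lintegral_image_eq_lintegral_abs_deriv_mul measurableSet_Ioi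
    (f' := fun _ => s) (fun x _ => by simpa using ((hasDerivAt_id x).const_mul s).hasDerivWithinAt)
    (fun x _ y _ h => mul_left_cancel₀ hs.ne' h), invGammaIntegral, ← lintegral_const_mul]
  · refine setLIntegral_congr_fun measurableSet_Ioi fun x (hx : 0 < x) => ?_
    rw [← ENNReal.ofReal_mul (abs_nonneg _), ← ENNReal.ofReal_mul (by positivity), abs_of_pos hs,
      Real.mul_rpow hs.le hx.le, show -(N / 2) = 1 + -(N / 2 + 1) by ring, Real.rpow_add hs,
      Real.rpow_one, show -s / (2 * (s * x)) = -1 / (2 * x) by field_simp]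
    ring_nf
  · fun_prop

theorem invGammaIntegral_ne_zero (N s : ℝ) : invGammaIntegral N s ≠ 0 := by
  rw [invGammaIntegral, ← pos_iff_ne_zero, setLIntegral_pos_iff (by fun_prop)]
  refine lt_of_lt_of_le (b := volume (Ioi (0 : ℝ))) (by simp)
    (measure_mono fun x (hx : 0 < x) => ⟨?_, hx⟩)
  simp only [Function.mem_support, ne_eq, ENNReal.ofReal_eq_zero, not_le]
  positivity

theorem invGammaIntegral_one_ne_top {N : ℝ} (hN : 0 < N) : invGammaIntegral N 1 ≠ ⊤ := by
  have gamma : IntegrableOn (fun x : ℝ => x ^ (N / 2 - 1) * Real.exp (-(1 / 2) * x)) (Ioi 0) := by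
    simpa using integrableOn_rpow_mul_exp_neg_mul_rpow (p := 1) (s := N / 2 - 1) (b := 1 / 2)
      (by linarith) (by norm_num) (by norm_num)
  rw [← integrableOn_Ioi_comp_rpow_iff _ (p := -1) (by norm_num)] at gamma
  have invGamma :
      IntegrableOn (fun x : ℝ => x ^ (-(N / 2 + 1)) * Real.exp (-1 / (2 * x))) (Ioi 0) := by
    refine gamma.congr_fun (fun x (hx : 0 < x) => ?_) measurableSet_Ioi
    simp only [smul_eq_mul]
    rw [← Real.rpow_mul hx.le, ← mul_assoc, abs_neg, abs_one, one_mul, ← Real.rpow_add hx,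
      Real.rpow_neg_one]
    congr 2
    · ring
    · field_simp
  exact (Integrable.lintegral_lt_top invGamma).ne

end InverseGamma

section Evidence

/-- The factor of the integrated likelihood that is common to all models. -/
def evidenceConst (n : ℕ) (a l : ℝ) : ℝ≥0∞ :=
  ENNReal.ofReal ((l / 2) ^ (a / 2) / Real.Gamma (a / 2) * (√(2 * Real.pi) ^ n)⁻¹) *
    invGammaIntegral (n + a) 1

theorem evidenceConst_ne_zero (n : ℕ) {a l : ℝ} (ha : 0 < a) (hl : 0 < l) :
    evidenceConst n a l ≠ 0 := by
  have := Real.Gamma_pos_of_pos (half_pos ha)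
  exact mul_ne_zero (ENNReal.ofReal_pos.2 (by positivity)).ne' (invGammaIntegral_ne_zero _ _)

theorem evidenceConst_ne_top (n : ℕ) {a : ℝ} (ha : 0 < a) (l : ℝ) : evidenceConst n a l ≠ ⊤ :=
  ENNReal.mul_ne_top ENNReal.ofReal_ne_top (invGammaIntegral_one_ne_top (by positivity))

theorem hat_cols_mul_cols {n p : ℕ} {X : Matrix (Fin n) (Fin p) ℝ} {k k' : Finset (Fin p)}
    (h : k ⊆ k') (hX : IsUnit (gram X k').det) : hat (cols X k') * cols X k = cols X k := by
  ext i j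
  exact congrFun (congrFun (hat_mul_self (X := cols X k') hX) i) ⟨j, h j.2⟩

namespace Problem

variable {n : ℕ} (D : Problem n) {k m : Finset (Fin D.p)}

theorem posDef_gram (hk : k.card ≤ D.pbar) : (gram D.X k).PosDef := by
  have posSemidef := Matrix.posSemidef_conjTranspose_mul_self (cols D.X k)
  rw [Matrix.conjTranspose_eq_transpose_of_trivial] at posSemidef
  exact posSemidef.posDef_iff_isUnit.2 ((Matrix.isUnit_iff_isUnit_det _).2 (D.gram_isUnit k hk))

theorem rho_pos (hk : k.card ≤ D.pbar) : ∀ x ∈ D.rho k, 0 < x :=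
  pos_of_mem_roots_charpoly_mul (D.V_posDef k hk) (D.posDef_gram hk)

theorem rhoProd_pos (hk : k.card ≤ D.pbar) : 0 < D.rhoProd k := by
  refine Multiset.prod_pos fun z hz => ?_
  obtain ⟨x, hx, rfl⟩ := Multiset.mem_map.1 hz
  have := D.rho_pos hk x hx
  have := D.tau_pos
  positivity

theorem rhoProd_eq_sqrt_det (hk : k.card ≤ D.pbar) :
    D.rhoProd k = √(1 + D.tau • (D.V k * gram D.X k)).det := by
  rw [det_one_add_smul_mul_eq_prod_roots (D.V_posDef k hk) (D.posDef_gram hk), Real.sqrt_eq_rpow,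
    rhoProd, Real.multiset_prod_map_rpow]
  · rfl
  · intro x hx
    have := D.rho_pos hk x hx
    have := D.tau_pos
    positivity

/-- The ridge residual sum of squares of model `k`, whose power is its integrated likelihood. -/
def fit (k : Finset (Fin D.p)) (y : Fin n → ℝ) : ℝ := ridgeRss (cols D.X k) (D.V k) D.tau y

theorem rss_le_fit (hk : k.card ≤ D.pbar) (y : Fin n → ℝ) : rss (cols D.X k) y ≤ D.fit k y :=
  rss_le_ridgeRss (D.gram_isUnit k hk) (D.V_posDef k hk) D.tau_pos y

theorem fit_nonneg (hk : k.card ≤ D.pbar) (y : Fin n → ℝ) : 0 ≤ D.fit k y :=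
  (rss_nonneg (D.gram_isUnit k hk) y).trans (D.rss_le_fit hk y)

theorem lintegral_likelihood {a l φ : ℝ} (ha : 0 < a) (hl : 0 < l) (hφ : 0 < φ)
    (hk : k.card ≤ D.pbar) (y : Fin n → ℝ) :
    ∫⁻ θ : k → ℝ, ENNReal.ofReal
        (normalPdf (cols D.X k *ᵥ θ) (φ • (1 : Matrix (Fin n) (Fin n) ℝ)) y *
          normalPdf 0 ((D.tau * φ) • D.V k) θ * invGammaPdf (a / 2) (l / 2) φ) =
      ENNReal.ofReal ((l / 2) ^ (a / 2) / Real.Gamma (a / 2) * (√(2 * Real.pi) ^ n)⁻¹ *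
          (D.rhoProd k)⁻¹) *
        ENNReal.ofReal (φ ^ (-((n + a) / 2 + 1)) * Real.exp (-(l + D.fit k y) / (2 * φ))) := by
  have := Real.Gamma_pos_of_pos (half_pos ha)
  have hprior : 0 ≤ invGammaPdf (a / 2) (l / 2) φ := by
    rw [invGammaPdf]
    positivity
  have hrho := D.rhoProd_pos hk
  have power : φ ^ (-((n + a) / 2 + 1)) = φ ^ (-(a / 2 + 1)) * (√φ ^ n)⁻¹ := by
    rw [Real.sqrt_eq_rpow, ← Real.rpow_mul_natCast hφ.le, ← Real.rpow_neg hφ.le,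
      ← Real.rpow_add hφ]
    congr 1
    ring
  have exponential : Real.exp (-(l + D.fit k y) / (2 * φ)) =
      Real.exp (-(l / 2) / φ) * Real.exp (-D.fit k y / (2 * φ)) := by
    rw [← Real.exp_add]
    congr 1
    field_simp
    ring
  simp only [ENNReal.ofReal_mul' hprior]
  rw [lintegral_mul_const' _ _ ENNReal.ofReal_ne_top,
    lintegral_normalPdf_mul_normalPdf _ (D.V_posDef k hk) D.tau_pos hφ, ← ENNReal.ofReal_mul',
    ← ENNReal.ofReal_mul (by positivity), power, exponential, ← gram, ← D.rhoProd_eq_sqrt_det hk,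
    ← fit, invGammaPdf, Fintype.card_fin, Real.sqrt_mul (by positivity) φ, mul_pow, mul_inv]
  · congr 1
    ring
  · exact hprior

theorem evidence_eq {a l : ℝ} (ha : 0 < a) (hl : 0 < l) (hk : k.card ≤ D.pbar) (y : Fin n → ℝ) :
    D.evidence a l k y = evidenceConst n a l *
      ENNReal.ofReal ((D.rhoProd k)⁻¹ * (l + D.fit k y) ^ (-((n + a) / 2))) := by
  have := Real.Gamma_pos_of_pos (half_pos ha)
  have hrho := D.rhoProd_pos hk
  rw [evidence, setLIntegral_congr_fun measurableSet_Ioi fun φ hφ =>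
      D.lintegral_likelihood ha hl hφ hk y, lintegral_const_mul _ (by fun_prop),
    ← invGammaIntegral,
    invGammaIntegral_eq_rpow_mul _ (add_pos_of_pos_of_nonneg hl (D.fit_nonneg hk y)),
    evidenceConst, ENNReal.ofReal_mul (by positivity), ENNReal.ofReal_mul (inv_nonneg.2 hrho.le)]
  ring

theorem posterior_nonneg (a l : ℝ) (m : Finset (Fin D.p)) (y : Fin n → ℝ) :
    0 ≤ D.posterior a l m y := ENNReal.toReal_nonneg

theorem evidence_mul_prior_le_sum (a l : ℝ) (hk : k.card ≤ D.pbar) (y : Fin n → ℝ) :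
    D.evidence a l k y * ENNReal.ofReal (D.prior k.card) ≤
      ∑ k : Finset (Fin D.p) with k.card ≤ D.pbar,
        D.evidence a l k y * ENNReal.ofReal (D.prior k.card) :=
  Finset.single_le_sum (f := fun k : Finset (Fin D.p) =>
    D.evidence a l k y * ENNReal.ofReal (D.prior k.card)) (fun _ _ => zero_le)
    (Finset.mem_filter.2 ⟨Finset.mem_univ k, hk⟩)

theorem posterior_le_one (a l : ℝ) (hm : m.card ≤ D.pbar) (y : Fin n → ℝ) :
    D.posterior a l m y ≤ 1 := by
  refine ENNReal.toReal_le_of_le_ofReal zero_le_one (ENNReal.div_le_of_le_mul ?_)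
  rw [ENNReal.ofReal_one, one_mul]
  exact D.evidence_mul_prior_le_sum a l hm y

theorem odds_pos (hm : m.card ≤ D.pbar) : 0 < D.odds m :=
  div_pos (D.prior_pos m hm) (D.prior_pos D.t D.t_card)

theorem posterior_le_posteriorOdds {a l : ℝ} (ha : 0 < a) (hl : 0 < l) (hm : m.card ≤ D.pbar)
    (y : Fin n → ℝ) :
    D.posterior a l m y ≤ D.odds m * (D.rhoProd D.t / D.rhoProd m) *
      ((l + D.fit D.t y) / (l + D.fit m y)) ^ (((n : ℝ) + a) / 2) := by
  have hpm := D.prior_pos m hm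
  have hpt := D.prior_pos D.t D.t_card
  have hrm := D.rhoProd_pos hm
  have hrt := D.rhoProd_pos D.t_card
  have hsm := add_pos_of_pos_of_nonneg hl (D.fit_nonneg hm y)
  have hst := add_pos_of_pos_of_nonneg hl (D.fit_nonneg D.t_card y)
  have ho := D.odds_pos hm
  refine ENNReal.toReal_le_of_le_ofReal (by positivity)
    ((ENNReal.div_le_div_left (D.evidence_mul_prior_le_sum a l D.t_card y) _).trans ?_)
  rw [D.evidence_eq ha hl hm, D.evidence_eq ha hl D.t_card, mul_assoc, mul_assoc,
    ENNReal.mul_div_mul_left _ _ (evidenceConst_ne_zero n ha hl) (evidenceConst_ne_top n ha l),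
    ← ENNReal.ofReal_mul (by positivity), ← ENNReal.ofReal_mul (by positivity),
    ← ENNReal.ofReal_div_of_pos (by positivity), Real.div_rpow hst.le hsm.le,
    Real.rpow_neg hst.le, Real.rpow_neg hsm.le, odds]
  refine ENNReal.ofReal_le_ofReal (le_of_eq ?_)
  have := Real.rpow_pos_of_pos hst (((n : ℝ) + a) / 2)
  have := Real.rpow_pos_of_pos hsm (((n : ℝ) + a) / 2)
  field_simp

theorem rhoMin_nonneg : 0 ≤ D.rhoMin :=
  Real.sInf_nonneg fun _ hx => (D.rho_pos D.t_card _ hx).le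

theorem rhoMin_le : ∀ x ∈ D.rho D.t, D.rhoMin ≤ x := fun _ hx =>
  csInf_le ⟨0, fun z hz => (D.rho_pos D.t_card z hz).le⟩ hx

theorem rhoMin_pos (ht : D.t.Nonempty) : 0 < D.rhoMin := by
  have hcard : 0 < (D.rho D.t).card := by
    rw [rho, card_roots_charpoly_mul (D.V_posDef D.t D.t_card) (D.posDef_gram D.t_card)]
    simpa using ht
  have nonempty : {x | x ∈ D.rho D.t}.Nonempty := Multiset.card_pos_iff_exists_mem.1 hcard
  have finite : {x | x ∈ D.rho D.t}.Finite := by simp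
  exact D.rho_pos D.t_card _ (nonempty.csInf_mem finite)

/-- A bound on the increase of the residual sum of squares of the true model due to the shrinkage
of its coefficients by the prior. -/
def shrinkage (y : Fin n → ℝ) : ℝ :=
  if D.t = ∅ then 0 else (y ⬝ᵥ (hat (cols D.X D.t) *ᵥ y)) / (D.tau * D.rhoMin)

theorem fit_le_rss_add_shrinkage (y : Fin n → ℝ) :
    D.fit D.t y ≤ rss (cols D.X D.t) y + D.shrinkage y := by
  rw [shrinkage, fit]
  split_ifs with ht
  · have : IsEmpty D.t := by rw [ht]; infer_instance
    rw [ridgeRss_of_isEmpty, add_zero]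
  · exact ridgeRss_le (D.gram_isUnit D.t D.t_card) (D.V_posDef _ D.t_card) D.tau_pos
      (D.rhoMin_pos (Finset.nonempty_iff_ne_empty.2 ht))
      (le_quadraticForm_of_le_roots_charpoly_mul (D.V_posDef _ D.t_card) (D.posDef_gram D.t_card)
        D.rhoMin_le) y

theorem posterior_le {a l c : ℝ} (ha : 0 < a) (hl : 0 < l) (hm : m.card ≤ D.pbar)
    {y : Fin n → ℝ} (hc : D.shrinkage y ≤ c) :
    D.posterior a l m y ≤ D.odds m * (D.rhoProd D.t / D.rhoProd m) *
      ((l + rss (cols D.X D.t) y + c) / (l + rss (cols D.X m) y)) ^ (((n : ℝ) + a) / 2) := by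
  have hft := D.fit_nonneg D.t_card y
  have hft' := D.fit_le_rss_add_shrinkage y
  have hfm := D.rss_le_fit hm y
  have hrss := rss_nonneg (D.gram_isUnit m hm) y
  have hodds := D.odds_pos hm
  have hrm := D.rhoProd_pos hm
  have hrt := D.rhoProd_pos D.t_card
  refine (D.posterior_le_posteriorOdds ha hl hm y).trans ?_
  gcongr ?_ * ?_ ^ _
  · exact div_nonneg (by linarith) (by linarith)
  · exact div_le_div₀ (by linarith) (by linarith) (by linarith) (by linarith)

end Problem

end Evidence

section TrueModel

theorem lintegral_le_measure_add_lintegral {α : Type*} [MeasurableSpace α] {μ : Measure α}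
    {E : Set α} {f g : α → ℝ≥0∞} (hE : ∀ x ∈ E, f x ≤ 1) (hg : ∀ x ∉ E, f x ≤ g x) :
    ∫⁻ x, f x ∂μ ≤ μ E + ∫⁻ x, g x ∂μ := by
  have hmeas := measurableSet_toMeasurable μ E
  calc ∫⁻ x, f x ∂μ ≤ ∫⁻ x, (toMeasurable μ E).indicator 1 x + g x ∂μ := by
        refine lintegral_mono fun x => ?_
        by_cases hx : x ∈ E
        · refine (hE x hx).trans (le_add_right ?_)
          rw [indicator_of_mem (subset_toMeasurable μ E hx), Pi.one_apply]
        · exact (hg x hx).trans (le_add_left le_rfl)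
    _ = μ E + ∫⁻ x, g x ∂μ := by
        rw [lintegral_add_left (measurable_one.indicator hmeas), lintegral_indicator_one hmeas,
          measure_toMeasurable]

namespace Problem

variable {n : ℕ} (D : Problem n) {k m : Finset (Fin D.p)}

theorem hat_mulVec_mean (h : D.t ⊆ k) (hk : k.card ≤ D.pbar) :
    hat (cols D.X k) *ᵥ D.mean = D.mean := by
  rw [mean, Matrix.mulVec_mulVec, hat_cols_mul_cols h (D.gram_isUnit k hk)]

theorem lam_eq (φ : ℝ) (m : Finset (Fin D.p)) : D.lam φ m = rss (cols D.X m) D.mean / φ := rfl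

theorem lam_empty (φ : ℝ) : D.lam φ ∅ = D.mean ⬝ᵥ D.mean / φ := by
  have : hat (cols D.X ∅) = 0 := by
    ext i j
    simp [hat, Matrix.mul_apply]
  rw [lam_eq, rss, this, sub_zero, Matrix.one_mulVec]

theorem lam_nonneg {φ : ℝ} (hφ : 0 < φ) (hm : m.card ≤ D.pbar) : 0 ≤ D.lam φ m :=
  div_nonneg (rss_nonneg (D.gram_isUnit m hm) _) hφ.le

theorem meanPosterior_nonneg (a l φ : ℝ) (m : Finset (Fin D.p)) : 0 ≤ D.meanPosterior a l φ m :=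
  integral_nonneg fun y => D.posterior_nonneg a l m y

theorem meanPosterior_le {a l φ : ℝ} (hm : m.card ≤ D.pbar) {E : Set (Fin n → ℝ)}
    {g : (Fin n → ℝ) → ℝ} (hg : ∀ y ∉ E, D.posterior a l m y ≤ g y) {b c : ℝ} (hb : 0 ≤ b)
    (hc : 0 ≤ c) (hE : D.truth φ E ≤ ENNReal.ofReal b)
    (hgc : ∫⁻ y, ENNReal.ofReal (g y) ∂(D.truth φ) ≤ ENNReal.ofReal c) :
    D.meanPosterior a l φ m ≤ b + c := by
  rw [← ENNReal.ofReal_le_ofReal_iff (add_nonneg hb hc),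
    ← Real.enorm_of_nonneg (D.meanPosterior_nonneg a l φ m), ENNReal.ofReal_add hb hc]
  refine (enorm_integral_le_lintegral_enorm _).trans
    ((lintegral_le_measure_add_lintegral (E := E) (fun y _ => ?_) fun y hy => ?_).trans
      (add_le_add hE hgc))
  · rw [Real.enorm_of_nonneg (D.posterior_nonneg a l m y)]
    exact ENNReal.ofReal_le_one.2 (D.posterior_le_one a l hm y)
  · rw [Real.enorm_of_nonneg (D.posterior_nonneg a l m y)]
    exact ENNReal.ofReal_le_ofReal (hg y hy)

/-- A bound on the probability that the shrinkage of the true model is large. -/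
def shrinkageTail : ℝ :=
  if D.t = ∅ then 0 else Real.exp ((D.t.card : ℝ) / 2 - D.tau * D.rhoMin)

theorem shrinkageTail_nonneg : 0 ≤ D.shrinkageTail := by
  rw [shrinkageTail]
  split_ifs <;> positivity

theorem measure_lt_shrinkage_le {φ : ℝ} (hφ : 0 < φ) (hlam : D.lam φ ∅ ≤ D.tau * D.rhoMin) :
    D.truth φ {y | 10 * φ < D.shrinkage y} ≤ ENNReal.ofReal D.shrinkageTail := by
  unfold shrinkage shrinkageTail
  split_ifs with ht
  · have : {_y : Fin n → ℝ | 10 * φ < 0} = ∅ := by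
      simp [not_lt.2 (by positivity : 0 ≤ 10 * φ)]
    rw [this, measure_empty]
    exact zero_le
  have hgram := D.gram_isUnit D.t D.t_card
  have hr := mul_pos D.tau_pos (D.rhoMin_pos (Finset.nonempty_iff_ne_empty.2 ht))
  set r := D.tau * D.rhoMin
  rw [D.lam_empty, div_le_iff₀ hφ] at hlam
  have hsub : {y | 10 * φ < (y ⬝ᵥ (hat (cols D.X D.t) *ᵥ y)) / r} ⊆
      {y | 4 * φ * r ≤ (y - D.mean) ⬝ᵥ (hat (cols D.X D.t) *ᵥ (y - D.mean))} := by
    intro y hy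
    rw [Set.mem_ofPred_eq, lt_div_iff₀ hr] at hy
    have hadd := quadraticForm_add_le (posSemidef_of_isStarProjection (isStarProjection_hat hgram))
      D.mean (y - D.mean)
    have hle := quadraticForm_le_of_isStarProjection (isStarProjection_hat hgram) D.mean
    rw [add_sub_cancel] at hadd
    rw [Set.mem_ofPred_eq]
    linarith
  refine (measure_mono hsub).trans
    ((measure_le_quadraticForm_hat hgram D.mean hφ (4 * φ * r)).trans_eq ?_)
  congr 2
  rw [Fintype.card_coe]
  field_simp

end Problem

end TrueModel

section RatioMoment

/-- The rate function `u - 1 - log u` of the lower large deviations of a chi-square variable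
divided by its degrees of freedom; it vanishes for `1 ≤ u`. -/
def lowerRate (u : ℝ) : ℝ := min u 1 - 1 - Real.log (min u 1)

theorem lowerRate_nonneg {u : ℝ} (hu : 0 < u) : 0 ≤ lowerRate u := by
  have := Real.log_le_sub_one_of_pos (lt_min hu one_pos)
  rw [lowerRate]
  linarith

theorem exists_sub_one_sub_log_eq {c : ℝ} (hc : 0 ≤ c) :
    ∃ v ∈ Ioc (0 : ℝ) 1, v - 1 - Real.log v = c := by
  have hle : Real.exp (-(c + 1)) ≤ 1 := Real.exp_le_one_iff.2 (by linarith)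
  have hcont : ContinuousOn (fun u => u - 1 - Real.log u) (Icc (Real.exp (-(c + 1))) 1) :=
    (continuousOn_id.sub continuousOn_const).sub
      (Real.continuousOn_log.mono fun x hx => ((Real.exp_pos _).trans_le hx.1).ne')
  obtain ⟨v, hv, hvc⟩ := intermediate_value_Icc' hle hcont
    ⟨by simpa using hc, by rw [Real.log_exp]; linarith [Real.exp_pos (-(c + 1))]⟩
  exact ⟨v, ⟨(Real.exp_pos _).trans_le hv.1, hv.2⟩, hvc⟩

theorem le_of_sub_one_sub_log_le {u v : ℝ} (hv : 0 < v) (hu1 : u ≤ 1)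
    (h : v - 1 - Real.log v ≤ u - 1 - Real.log u) : u ≤ v := by
  by_contra! hlt
  have hu := hv.trans hlt
  have hlog := Real.log_lt_sub_one_of_pos (div_pos hv hu) ((div_lt_one hu).2 hlt).ne
  rw [Real.log_div hv.ne' hu.ne'] at hlog
  have : v / u - 1 ≤ v - u := by
    rw [div_sub_one hu.ne', div_le_iff₀ hu]
    nlinarith
  linarith

-- The optimal slope in Chernoff's bound for the event `c ≤ lowerRate u`.
theorem exists_exp_le_of_le_lowerRate {c : ℝ} (hc : 0 ≤ c) :
    ∃ b, 0 ≤ b ∧ ∀ u, c ≤ lowerRate u → Real.exp c ≤ (1 + b) * Real.exp (-(b * u)) := by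
  obtain ⟨v, ⟨hv, hv1⟩, hvc⟩ := exists_sub_one_sub_log_eq hc
  have hb : 0 ≤ v⁻¹ - 1 := sub_nonneg.2 ((one_le_inv₀ hv).2 hv1)
  refine ⟨v⁻¹ - 1, hb, fun u hcu => ?_⟩
  have hmin : min u 1 ≤ v := le_of_sub_one_sub_log_le hv (min_le_right u 1) (hvc.trans_le hcu)
  have slope : (v⁻¹ - 1) * u ≤ (v⁻¹ - 1) * v := by
    rcases min_le_iff.1 hmin with h | h
    · gcongr
    · simp [le_antisymm hv1 h]
  calc Real.exp c = (1 + (v⁻¹ - 1)) * Real.exp (-((v⁻¹ - 1) * v)) := by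
        rw [← hvc, Real.exp_sub, Real.exp_log hv, sub_mul, inv_mul_cancel₀ hv.ne', one_mul,
          neg_sub, add_sub_cancel, div_eq_inv_mul]
    _ ≤ _ := by gcongr

theorem one_add_div_rpow_le {ν u x : ℝ} (hν : 0 < ν) (hu : 0 ≤ u) (hx : 0 < x) :
    (1 + u / x) ^ (ν / 2) ≤ Real.exp (ν / 2 * lowerRate (x / ν) + u / 2) := by
  have hz : 0 < min (x / ν) 1 := lt_min (by positivity) one_pos
  set z := min (x / ν) 1 with hzdef
  have hle : 1 + u / x ≤ (z + u / ν) / z := by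
    rw [add_div, div_self hz.ne', div_div]
    gcongr
    exact (mul_le_mul_of_nonneg_left (min_le_left _ _) hν.le).trans_eq (mul_div_cancel₀ x hν.ne')
  calc (1 + u / x) ^ (ν / 2) ≤ ((z + u / ν) / z) ^ (ν / 2) := by gcongr
    _ = Real.exp (ν / 2 * (Real.log (z + u / ν) - Real.log z)) := by
        rw [Real.rpow_def_of_pos (by positivity), Real.log_div (by positivity) hz.ne', mul_comm]
    _ ≤ Real.exp (ν / 2 * (z + u / ν - 1 - Real.log z)) := by
        gcongr
        exact Real.log_le_sub_one_of_pos (by positivity)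
    _ = _ := by
        rw [lowerRate, ← hzdef]
        congr 1
        field_simp
        ring

theorem exp_le_one_add_rpow_mul_exp {ν b c x : ℝ} (hν : 0 < ν) (hb : 0 ≤ b)
    (h : Real.exp (c / (ν / 2)) ≤ (1 + b) * Real.exp (-(b * (x / ν)))) :
    Real.exp c ≤ (1 + b) ^ (ν / 2) * Real.exp (-(b * x) / 2) := by
  calc Real.exp c = Real.exp (c / (ν / 2)) ^ (ν / 2) := by
        rw [← Real.exp_mul, div_mul_cancel₀ _ (by positivity)]
    _ ≤ ((1 + b) * Real.exp (-(b * (x / ν)))) ^ (ν / 2) := by gcongr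
    _ = _ := by
        rw [Real.mul_rpow (by positivity) (by positivity), ← Real.exp_mul]
        congr 2
        field_simp

-- Slicing `exp (s * w)` along the integer part `j` of `w = ν / 2 * lowerRate (x / ν)` turns it into
-- a sum of terms `exp (s * (j + 1))` on the events `j ≤ w`, each of which is exponentially bounded.
theorem exists_envelope {ν s : ℝ} (hν : 0 < ν) (hs : 0 ≤ s) :
    ∃ b : ℕ → ℝ, (∀ j, 0 ≤ b j) ∧ ∀ u x : ℝ, 0 ≤ u → 0 < x → ∃ j : ℕ,
      (1 + u / x) ^ (s * ν / 2) ≤ Real.exp (s * (j + 1) - j) *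
        ((1 + b j) ^ (ν / 2) * Real.exp ((s * u - b j * x) / 2)) := by
  choose b hb0 hb using fun j : ℕ =>
    exists_exp_le_of_le_lowerRate (c := j / (ν / 2)) (by positivity)
  refine ⟨b, hb0, fun u x hu hx => ?_⟩
  set w := ν / 2 * lowerRate (x / ν)
  have hw0 : 0 ≤ w := mul_nonneg (by positivity) (lowerRate_nonneg (by positivity))
  refine ⟨⌊w⌋₊, ?_⟩
  have chernoff : Real.exp ⌊w⌋₊ ≤ (1 + b ⌊w⌋₊) ^ (ν / 2) * Real.exp (-(b ⌊w⌋₊ * x) / 2) :=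
    exp_le_one_add_rpow_mul_exp hν (hb0 _)
      (hb _ (x / ν) ((div_le_iff₀' (by positivity)).2 (Nat.floor_le hw0)))
  have := hb0 ⌊w⌋₊
  calc (1 + u / x) ^ (s * ν / 2) = ((1 + u / x) ^ (ν / 2)) ^ s := by
        rw [← Real.rpow_mul (by positivity)]
        ring_nf
    _ ≤ Real.exp (w + u / 2) ^ s := by
        gcongr
        exact one_add_div_rpow_le hν hu hx
    _ = Real.exp (s * w + s * u / 2) := by rw [← Real.exp_mul]; ring_nf
    _ ≤ Real.exp (s * (⌊w⌋₊ + 1) + s * u / 2) := by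
        gcongr
        exact (Nat.lt_floor_add_one w).le
    _ = Real.exp (s * (⌊w⌋₊ + 1) - ⌊w⌋₊) * (Real.exp ⌊w⌋₊ * Real.exp (s * u / 2)) := by
        rw [← Real.exp_add, ← Real.exp_add]
        ring_nf
    _ ≤ Real.exp (s * (⌊w⌋₊ + 1) - ⌊w⌋₊) * ((1 + b ⌊w⌋₊) ^ (ν / 2) *
          Real.exp (-(b ⌊w⌋₊ * x) / 2) * Real.exp (s * u / 2)) := by gcongr
    _ = _ := by
        rw [mul_assoc ((1 + b ⌊w⌋₊) ^ (ν / 2)), ← Real.exp_add]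
        ring_nf

/-- The total weight of the exponential envelopes of a power `s` of the ratio of residual sums of
squares of nested models. -/
def envelopeConst (s : ℝ) : ℝ := Real.exp s * (1 - Real.exp (-(1 - s)))⁻¹

theorem envelopeConst_nonneg {s : ℝ} (hs : s < 1) : 0 ≤ envelopeConst s := by
  have : Real.exp (-(1 - s)) ≤ 1 := Real.exp_le_one_iff.2 (by linarith)
  exact mul_nonneg (Real.exp_pos _).le (inv_nonneg.2 (by linarith))

theorem tsum_exp_mul_succ_sub {s : ℝ} (hs : s < 1) :
    ∑' j : ℕ, ENNReal.ofReal (Real.exp (s * (j + 1) - j)) = ENNReal.ofReal (envelopeConst s) := by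
  have hlt : Real.exp (-(1 - s)) < 1 := Real.exp_lt_one_iff.2 (by linarith)
  have geometric (j : ℕ) : Real.exp (s * (j + 1) - j) = Real.exp s * Real.exp (-(1 - s)) ^ j := by
    rw [← Real.exp_nat_mul, ← Real.exp_add]
    ring_nf
  simp only [geometric]
  rw [← ENNReal.ofReal_tsum_of_nonneg (fun j => by positivity)
    ((summable_geometric_of_lt_one (Real.exp_pos _).le hlt).mul_left _), tsum_mul_left,
    tsum_geometric_of_lt_one (Real.exp_pos _).le hlt, envelopeConst]

variable {ι κ κ' : Type} [Fintype ι] [DecidableEq ι] [Fintype κ] [DecidableEq κ] [Fintype κ']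
  [DecidableEq κ'] {X : Matrix ι κ ℝ} {Y : Matrix ι κ' ℝ}

theorem lintegral_rpow_mul_exp_nestedForm (hX : IsUnit (Xᵀ * X).det) (hY : IsUnit (Yᵀ * Y).det)
    (hYX : hat Y * X = X) {b s φ : ℝ} (hb : 0 ≤ b) (hs : s < 1) (hφ : 0 < φ) (μ : ι → ℝ) :
    ∫⁻ y, ENNReal.ofReal ((1 + b) ^ (((Fintype.card ι : ℝ) - Fintype.card κ') / 2) *
        Real.exp (((y - μ) ⬝ᵥ (nestedForm X Y 0 s (-b) *ᵥ (y - μ))) / (2 * φ)))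
        ∂(isotropicGaussian μ φ) =
      ENNReal.ofReal ((1 - s) ^ (-((Fintype.card κ' - Fintype.card κ) / 2 : ℝ))) := by
  simp only [ENNReal.ofReal_mul (Real.rpow_nonneg (by positivity : 0 ≤ 1 + b) _)]
  rw [lintegral_const_mul' _ _ ENNReal.ofReal_ne_top, lintegral_exp_nestedForm hX hY hYX
    zero_lt_one hs (by linarith) μ hφ, ← ENNReal.ofReal_mul (by positivity), sub_zero,
    Real.one_rpow, one_mul, sub_neg_eq_add, Real.rpow_neg (by positivity : 0 ≤ 1 + b), mul_comm,
    mul_assoc, inv_mul_cancel₀ (by positivity), mul_one]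

theorem exists_envelope_nestedForm (hX : IsUnit (Xᵀ * X).det)
    (hY : IsUnit (Yᵀ * Y).det) (hYX : hat Y * X = X) {l ν s φ : ℝ} (hl : 0 < l) (hν : 0 < ν)
    (hs : 0 ≤ s) (hφ : 0 < φ) :
    ∃ b : ℕ → ℝ, (∀ j, 0 ≤ b j) ∧ ∀ x : ι → ℝ, ∃ j : ℕ,
      (1 + (x ⬝ᵥ ((hat Y - hat X) *ᵥ x)) / (l + rss Y x)) ^ (s * ν / 2) ≤
        Real.exp (s * (j + 1) - j) * ((1 + b j) ^ (ν / 2) *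
          Real.exp ((x ⬝ᵥ (nestedForm X Y 0 s (-b j) *ᵥ x)) / (2 * φ))) := by
  obtain ⟨b, hb0, hb⟩ := exists_envelope hν hs
  refine ⟨b, hb0, fun x => ?_⟩
  have hU := quadraticForm_nonneg
    (posSemidef_of_isStarProjection (isStarProjection_hat_sub_hat hX hY hYX)) x
  have hR := rss_nonneg hY x
  set U := x ⬝ᵥ ((hat Y - hat X) *ᵥ x) with hUdef
  set R := rss Y x
  obtain ⟨j, hj⟩ := hb (U / φ) ((l + R) / φ) (by positivity) (by positivity)
  rw [div_div_div_cancel_right₀ hφ.ne'] at hj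
  have := hb0 j
  have exponent : (s * (U / φ) - b j * ((l + R) / φ)) / 2 ≤ (s * U - b j * R) / (2 * φ) := by
    have drop : (s * (U / φ) - b j * ((l + R) / φ)) / 2 =
        (s * U - b j * R) / (2 * φ) - b j * l / (2 * φ) := by
      field_simp
      ring
    rw [drop, sub_le_self_iff]
    positivity
  refine ⟨j, hj.trans ?_⟩
  rw [quadraticForm_nestedForm, zero_mul, zero_add, neg_mul, ← sub_eq_add_neg, ← hUdef]
  gcongr Real.exp (_ - _) * (_ * Real.exp ?_)

theorem lintegral_one_add_div_rpow_le (hX : IsUnit (Xᵀ * X).det) (hY : IsUnit (Yᵀ * Y).det)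
    (hYX : hat Y * X = X) (hcard : Fintype.card κ' < Fintype.card ι) {l s φ : ℝ} (hl : 0 < l)
    (hs : 0 ≤ s) (hs1 : s < 1) (hφ : 0 < φ) (μ : ι → ℝ) :
    ∫⁻ y, ENNReal.ofReal ((1 + ((y - μ) ⬝ᵥ ((hat Y - hat X) *ᵥ (y - μ))) / (l + rss Y (y - μ))) ^
        (s * (Fintype.card ι - Fintype.card κ') / 2)) ∂(isotropicGaussian μ φ) ≤
      ENNReal.ofReal (envelopeConst s *
        (1 - s) ^ (-((Fintype.card κ' - Fintype.card κ) / 2 : ℝ))) := by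
  set ν : ℝ := Fintype.card ι - Fintype.card κ'
  have hν : 0 < ν := sub_pos.2 (Nat.cast_lt.2 hcard)
  obtain ⟨b, hb0, hb⟩ := exists_envelope_nestedForm hX hY hYX hl hν hs hφ
  set F : ℕ → (ι → ℝ) → ℝ := fun j y => (1 + b j) ^ (ν / 2) *
    Real.exp (((y - μ) ⬝ᵥ (nestedForm X Y 0 s (-b j) *ᵥ (y - μ))) / (2 * φ)) with hF
  have hF_meas (j : ℕ) : Measurable (F j) := by
    simp only [hF, dotProduct, Matrix.mulVec, Pi.sub_apply]
    fun_prop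
  calc _ ≤ ∫⁻ y, ∑' j : ℕ, ENNReal.ofReal (Real.exp (s * (j + 1) - j)) * ENNReal.ofReal (F j y)
          ∂(isotropicGaussian μ φ) := lintegral_mono fun y => by
        obtain ⟨j, hj⟩ := hb (y - μ)
        refine le_trans ?_ (ENNReal.le_tsum j)
        rw [← ENNReal.ofReal_mul (Real.exp_nonneg _)]
        exact ENNReal.ofReal_le_ofReal hj
    _ = ∑' j : ℕ, ENNReal.ofReal (Real.exp (s * (j + 1) - j)) *
          ENNReal.ofReal ((1 - s) ^ (-((Fintype.card κ' - Fintype.card κ) / 2 : ℝ))) := by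
        rw [lintegral_tsum fun j => by fun_prop]
        refine tsum_congr fun j => ?_
        rw [lintegral_const_mul _ (by fun_prop),
          lintegral_rpow_mul_exp_nestedForm hX hY hYX (hb0 j) hs1 hφ μ]
    _ = _ := by
        rw [ENNReal.tsum_mul_right, tsum_exp_mul_succ_sub hs1,
          ← ENNReal.ofReal_mul (envelopeConst_nonneg hs1)]

end RatioMoment

section FiniteSample

theorem one_add_div_rpow_le_exp {a b s N : ℝ} (ha : 0 ≤ a) (hb : 0 ≤ b) (hs : s ∈ Icc (0 : ℝ) 1)
    (hN : 1 ≤ N) : (1 + b / N) ^ (s * (N + a) / 2) ≤ Real.exp (b * (1 + a) / 2) := by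
  have : 0 < N := one_pos.trans_le hN
  have hs0 := hs.1
  calc (1 + b / N) ^ (s * (N + a) / 2) ≤ Real.exp (b / N) ^ (s * (N + a) / 2) := by
        gcongr
        rw [add_comm]
        exact Real.add_one_le_exp _
    _ = Real.exp (b * (s * (1 + a / N)) / 2) := by
        rw [← Real.exp_mul]
        congr 1
        field_simp
    _ ≤ Real.exp (b * (1 * (1 + a)) / 2) := by
        gcongr
        · exact hs.2
        · exact div_le_self ha hN
    _ = Real.exp (b * (1 + a) / 2) := by rw [one_mul]

theorem add_div_add_le_mul {l c δ R U : ℝ} (hl : 0 < l) (hδ : 0 ≤ δ) (hR : 0 ≤ R)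
    (hc : c ≤ δ * (R + U)) :
    (l + (R + U) + c) / (l + R) ≤ (1 + δ) * (1 + U / (l + R)) := by
  calc (l + (R + U) + c) / (l + R) ≤ (1 + δ) * (l + R + U) / (l + R) := by
        gcongr
        linarith [mul_nonneg hδ hl.le]
    _ = (1 + δ) * (1 + U / (l + R)) := by
        field_simp

theorem le_rpow_mul_rpow_of_le {p x b z s : ℝ} (hp : p ∈ Icc (0 : ℝ) 1) (hx : 0 ≤ x) (hb : 0 ≤ b)
    (hs : s ∈ Icc (0 : ℝ) 1) (h : p ≤ x * b ^ z) : p ≤ x ^ s * b ^ (s * z) := by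
  calc p ≤ p ^ s := by simpa using Real.rpow_le_rpow_of_exponent_ge' hp.1 hp.2 hs.1 hs.2
    _ ≤ (x * b ^ z) ^ s := Real.rpow_le_rpow hp.1 h hs.1
    _ = x ^ s * b ^ (s * z) := by
        rw [Real.mul_rpow hx (Real.rpow_nonneg hb z), ← Real.rpow_mul hb, mul_comm z]

theorem le_inv_one_add_of_add_le {x b u c : ℝ} (hx : 0 ≤ x) (hxc : x ≤ c) (hc : 0 < c)
    (hu : 0 ≤ u) (hb : x + u ≤ b) : x / b ≤ (1 + u / c)⁻¹ := by
  rcases hx.eq_or_lt with rfl | hx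
  · rw [zero_div]
    positivity
  calc x / b ≤ x / (x + u) := by gcongr
    _ = (1 + u / x)⁻¹ := by field_simp
    _ ≤ (1 + u / c)⁻¹ := by gcongr

namespace Problem

variable {n : ℕ} (D : Problem n) {m : Finset (Fin D.p)}

theorem rss_true_sub_mean (y : Fin n → ℝ) :
    rss (cols D.X D.t) (y - D.mean) = rss (cols D.X D.t) y :=
  rss_sub_of_hat_mulVec (D.gram_isUnit D.t D.t_card) (D.hat_mulVec_mean subset_rfl D.t_card) y

theorem rss_true_le_dotProduct_self (y : Fin n → ℝ) :
    rss (cols D.X D.t) y ≤ (y - D.mean) ⬝ᵥ (y - D.mean) := by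
  rw [← D.rss_true_sub_mean y]
  exact quadraticForm_le_of_isStarProjection
    (isStarProjection_hat (D.gram_isUnit D.t D.t_card)).one_sub _

theorem posterior_le_mul_rpow {a l φ e s s' : ℝ} (ha : 0 < a) (hl : 0 < l) (hφ : 0 < φ)
    (hm : D.Spurious m) (hn : 0 < n) (he : 0 < e) (hs : s ∈ Icc (0 : ℝ) 1)
    (hss : s * (n + a) ≤ s' * (n - m.card)) {y : Fin n → ℝ} (hW : D.shrinkage y ≤ 10 * φ)
    (hR : e * n * φ ≤ rss (cols D.X D.t) (y - D.mean)) :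
    D.posterior a l m y ≤ (D.odds m * (D.rhoProd D.t / D.rhoProd m)) ^ s *
      Real.exp (10 / e * (1 + a) / 2) *
      (1 + ((y - D.mean) ⬝ᵥ ((hat (cols D.X m) - hat (cols D.X D.t)) *ᵥ (y - D.mean))) /
        (l + rss (cols D.X m) (y - D.mean))) ^ (s' * (n - m.card) / 2) := by
  have hUt := D.gram_isUnit D.t D.t_card
  have hUm := D.gram_isUnit m hm.2
  have hn' : (1 : ℝ) ≤ n := Nat.one_le_cast.2 hn
  have hodds := D.odds_pos hm.2
  have hrm := D.rhoProd_pos hm.2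
  have hrt := D.rhoProd_pos D.t_card
  have hpost := D.posterior_le ha hl hm.2 hW
  rw [← D.rss_true_sub_mean y,
    ← rss_sub_of_hat_mulVec hUm (D.hat_mulVec_mean hm.1.subset hm.2) y] at hpost
  have hU : 0 ≤ (y - D.mean) ⬝ᵥ ((hat (cols D.X m) - hat (cols D.X D.t)) *ᵥ (y - D.mean)) :=
    quadraticForm_nonneg (posSemidef_of_isStarProjection (isStarProjection_hat_sub_hat hUt hUm
      (hat_cols_mul_cols hm.1.subset hUm))) _
  rw [rss_eq_rss_add (cols D.X D.t) (cols D.X m)] at hpost hR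
  set U := (y - D.mean) ⬝ᵥ ((hat (cols D.X m) - hat (cols D.X D.t)) *ᵥ (y - D.mean))
  have hR0 : 0 ≤ rss (cols D.X m) (y - D.mean) := rss_nonneg hUm _
  set R := rss (cols D.X m) (y - D.mean)
  have hratio := add_div_add_le_mul (δ := 10 / e / n) (U := U) (c := 10 * φ) hl (by positivity)
    hR0 <| by
      rw [div_div, div_mul_eq_mul_div, le_div_iff₀ (by positivity)]
      linarith
  have hone : 1 ≤ 1 + U / (l + R) := le_add_of_nonneg_right (by positivity)
  have hpost' : D.posterior a l m y ≤ D.odds m * (D.rhoProd D.t / D.rhoProd m) *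
      ((1 + 10 / e / n) * (1 + U / (l + R))) ^ (((n : ℝ) + a) / 2) := hpost.trans (by gcongr)
  refine (le_rpow_mul_rpow_of_le ⟨D.posterior_nonneg a l m y, D.posterior_le_one a l hm.2 y⟩
    (by positivity) (by positivity) hs hpost').trans ?_
  rw [Real.mul_rpow (x := 1 + 10 / e / n) (by positivity) (by positivity), ← mul_assoc,
    ← mul_div_assoc s]
  gcongr
  exact one_add_div_rpow_le_exp ha.le (by positivity) hs hn'

theorem meanPosterior_le_of_spurious {a l φ e s s' : ℝ} (ha : 0 < a) (hl : 0 < l) (hφ : 0 < φ)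
    (hm : D.Spurious m) (hn : 0 < n) (hlam : D.lam φ ∅ ≤ D.tau * D.rhoMin) (he : e ∈ Ioc (0 : ℝ) 1)
    (hs : s ∈ Icc (0 : ℝ) 1) (hs' : s' ∈ Ico (0 : ℝ) 1) (hcard : m.card < n)
    (hss : s * (n + a) ≤ s' * (n - m.card)) :
    D.meanPosterior a l φ m ≤
      D.shrinkageTail + Real.exp (n / 2) * e ^ (((n : ℝ) - D.t.card) / 2) +
        (D.odds m * (D.rhoProd D.t / D.rhoProd m)) ^ s * Real.exp (10 / e * (1 + a) / 2) *
          (envelopeConst s' * (1 - s') ^ (-(D.sizeDiff m / 2))) := by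
  have hUt := D.gram_isUnit D.t D.t_card
  have hUm := D.gram_isUnit m hm.2
  have hodds := D.odds_pos hm.2
  have hrm := D.rhoProd_pos hm.2
  have hrt := D.rhoProd_pos D.t_card
  have he0 := he.1
  have hs1 : 0 < 1 - s' := sub_pos.2 hs'.2
  have henv := envelopeConst_nonneg hs'.2
  have hconst : 0 ≤ (D.odds m * (D.rhoProd D.t / D.rhoProd m)) ^ s *
      Real.exp (10 / e * (1 + a) / 2) := by positivity
  have htail := D.shrinkageTail_nonneg
  refine D.meanPosterior_le hm.2 (E := {y | 10 * φ < D.shrinkage y} ∪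
    {y | rss (cols D.X D.t) (y - D.mean) ≤ e * n * φ})
    (fun y hy => D.posterior_le_mul_rpow ha hl hφ hm hn he0 hs hss
      (not_lt.1 fun h => hy (.inl h)) (not_le.1 fun h => hy (.inr h)).le)
    (by positivity) (by positivity) ?_ ?_
  · rw [ENNReal.ofReal_add htail (by positivity)]
    refine (measure_union_le _ _).trans (add_le_add (D.measure_lt_shrinkage_le hφ hlam) ?_)
    have hrss := measure_rss_le hUt D.mean hφ he0 he.2
    rwa [Fintype.card_coe, Fintype.card_fin] at hrss
  · have hmoment := lintegral_one_add_div_rpow_le hUt hUm (hat_cols_mul_cols hm.1.subset hUm)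
      (by simpa using hcard) hl hs'.1 hs'.2 hφ D.mean
    simp only [Fintype.card_coe, Fintype.card_fin] at hmoment
    simp only [ENNReal.ofReal_mul hconst]
    rw [lintegral_const_mul' _ _ ENNReal.ofReal_ne_top, sizeDiff]
    gcongr
    exact hmoment

theorem rss_true_add_le_rss {φ : ℝ} (hφ : 0 < φ) {y : Fin n → ℝ}
    (hproj : (y - D.mean) ⬝ᵥ (hat (cols D.X m) *ᵥ (y - D.mean)) ≤ D.lam φ m * φ / 8)
    (hcross : -(D.lam φ m * φ / 8) ≤ ((1 - hat (cols D.X m)) *ᵥ D.mean) ⬝ᵥ (y - D.mean)) :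
    rss (cols D.X D.t) y + 5 / 8 * (D.lam φ m * φ) ≤ rss (cols D.X m) y := by
  have hsignal : rss (cols D.X m) D.mean = D.lam φ m * φ := by
    rw [lam_eq, div_mul_cancel₀ _ hφ.ne']
  have hexpand := rss_add (cols D.X m) D.mean (y - D.mean)
  rw [add_sub_cancel, hsignal, rss_eq_sub _ (y - D.mean)] at hexpand
  have htrue := D.rss_true_le_dotProduct_self y
  linarith

theorem posterior_le_mul_rpow_neg {a l φ M : ℝ} (ha : 0 < a) (hl : 0 < l) (hφ : 0 < φ)
    (hM : 0 ≤ M) (hm : m.card ≤ D.pbar) (hn : 0 < n) (hlam : 80 ≤ D.lam φ m) {y : Fin n → ℝ}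
    (hW : D.shrinkage y ≤ 10 * φ)
    (hnoise : (y - D.mean) ⬝ᵥ (y - D.mean) ≤ M * n * φ)
    (hgap : rss (cols D.X D.t) y + 5 / 8 * (D.lam φ m * φ) ≤ rss (cols D.X m) y) :
    D.posterior a l m y ≤ D.odds m * (D.rhoProd D.t / D.rhoProd m) *
      (1 + D.lam φ m / (2 * (l / φ + M + 10) * n)) ^ (-((n : ℝ) / 2)) := by
  have hn' : (1 : ℝ) ≤ n := Nat.one_le_cast.2 hn
  have hodds := D.odds_pos hm
  have hrm := D.rhoProd_pos hm
  have hrt := D.rhoProd_pos D.t_card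
  have hrss_t := rss_nonneg (D.gram_isUnit D.t D.t_card) y
  have hrss_m := rss_nonneg (D.gram_isUnit m hm) y
  have htrue := D.rss_true_le_dotProduct_self y
  have hnum : l + rss (cols D.X D.t) y + 10 * φ ≤ (l / φ + M + 10) * n * φ := by
    have : (l / φ + M + 10) * n * φ = (l + 10 * φ) * n + M * n * φ := by
      field_simp
      ring
    have : l + 10 * φ ≤ (l + 10 * φ) * n := le_mul_of_one_le_right (by positivity) hn'
    linarith
  have hratio := le_inv_one_add_of_add_le (x := l + rss (cols D.X D.t) y + 10 * φ)
    (b := l + rss (cols D.X m) y) (u := D.lam φ m * φ / 2) (by positivity) hnum (by positivity)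
    (by positivity) (by linarith [mul_le_mul_of_nonneg_right hlam hφ.le])
  have hscale : D.lam φ m * φ / 2 / ((l / φ + M + 10) * n * φ) =
      D.lam φ m / (2 * (l / φ + M + 10) * n) := by
    field_simp
  rw [hscale] at hratio
  have hbase : 1 ≤ 1 + D.lam φ m / (2 * (l / φ + M + 10) * n) :=
    le_add_of_nonneg_right (by positivity)
  refine (D.posterior_le ha hl hm hW).trans (mul_le_mul_of_nonneg_left ?_ (by positivity))
  rw [Real.rpow_neg (by positivity), ← Real.inv_rpow (by positivity)]
  refine (Real.rpow_le_rpow (by positivity) hratio (by positivity)).trans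
    (Real.rpow_le_rpow_of_exponent_ge (by positivity) (inv_le_one_of_one_le₀ hbase) (by linarith))

theorem measure_cross_le {φ : ℝ} (hφ : 0 < φ) (hm : m.card ≤ D.pbar) (hlam : 0 < D.lam φ m) :
    D.truth φ {y | ((1 - hat (cols D.X m)) *ᵥ D.mean) ⬝ᵥ (y - D.mean) ≤ -(D.lam φ m * φ / 8)} ≤
      ENNReal.ofReal (Real.exp (-(D.lam φ m / 128))) := by
  refine (measure_dotProduct_le_neg D.mean _ hφ (by positivity)).trans_eq ?_
  rw [← dotProduct_mulVec_of_isStarProjection (isStarProjection_hat (D.gram_isUnit m hm)).one_sub,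
    ← rss, ← div_mul_cancel₀ (rss (cols D.X m) D.mean) hφ.ne', ← lam_eq]
  congr 3
  field_simp
  norm_num

theorem meanPosterior_le_of_nonSpurious {a l φ M : ℝ} (ha : 0 < a) (hl : 0 < l) (hφ : 0 < φ)
    (hM : 0 ≤ M) (hm : D.NonSpurious m) (hn : 0 < n) (hlam₀ : D.lam φ ∅ ≤ D.tau * D.rhoMin)
    (hlam : 80 ≤ D.lam φ m) :
    D.meanPosterior a l φ m ≤
      D.shrinkageTail + Real.exp (n / 2 - M * n / 4) + Real.exp (m.card / 2 - D.lam φ m / 32) +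
        Real.exp (-(D.lam φ m / 128)) +
        D.odds m * (D.rhoProd D.t / D.rhoProd m) *
          (1 + D.lam φ m / (2 * (l / φ + M + 10) * n)) ^ (-((n : ℝ) / 2)) := by
  have hodds := D.odds_pos hm.2
  have hrm := D.rhoProd_pos hm.2
  have hrt := D.rhoProd_pos D.t_card
  have htail := D.shrinkageTail_nonneg
  refine D.meanPosterior_le hm.2 (E := {y | 10 * φ < D.shrinkage y} ∪
    {y | M * n * φ ≤ (y - D.mean) ⬝ᵥ (y - D.mean)} ∪
    {y | D.lam φ m * φ / 8 ≤ (y - D.mean) ⬝ᵥ (hat (cols D.X m) *ᵥ (y - D.mean))} ∪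
    {y | ((1 - hat (cols D.X m)) *ᵥ D.mean) ⬝ᵥ (y - D.mean) ≤ -(D.lam φ m * φ / 8)})
    (fun y hy => D.posterior_le_mul_rpow_neg ha hl hφ hM hm.2 hn hlam
      (not_lt.1 fun h => hy (.inl (.inl (.inl h))))
      (not_le.1 fun h => hy (.inl (.inl (.inr h)))).le
      (D.rss_true_add_le_rss hφ (not_le.1 fun h => hy (.inl (.inr h))).le
        (not_le.1 fun h => hy (.inr h)).le))
    (by positivity) (by positivity) ?_ ?_
  · rw [ENNReal.ofReal_add (by positivity) (by positivity),
      ENNReal.ofReal_add (by positivity) (by positivity), ENNReal.ofReal_add htail (by positivity)]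
    refine (measure_union_le _ _).trans (add_le_add ((measure_union_le _ _).trans (add_le_add
      ((measure_union_le _ _).trans (add_le_add (D.measure_lt_shrinkage_le hφ hlam₀) ?_)) ?_))
      (D.measure_cross_le hφ hm.2 (by linarith)))
    · refine (measure_le_dotProduct_self D.mean hφ _).trans_eq ?_
      congr 2
      rw [Fintype.card_fin]
      field_simp
    · refine (measure_le_quadraticForm_hat (D.gram_isUnit m hm.2) D.mean hφ _).trans_eq ?_
      congr 2
      rw [Fintype.card_coe]
      field_simp
      ring
  · rw [lintegral_const, truth, measure_univ, mul_one]

end Problem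

end FiniteSample

section Asymptotics

theorem isBigO_of_eventually_mem_Icc {f g : ℕ → ℝ} (h : ∀ᶠ n in atTop, f n ∈ Icc 0 (g n)) :
    f =O[atTop] g :=
  .of_norm_eventuallyLE (h.mono fun _ hn => (Real.norm_of_nonneg hn.1).trans_le hn.2)

theorem tendsto_const_mul_sub_atTop {x v : ℕ → ℝ} (hx : Tendsto x atTop atTop)
    (hv : v =o[atTop] x) {c : ℝ} (hc : 0 < c) :
    Tendsto (fun n => c * x n - v n) atTop atTop := by
  refine tendsto_atTop_mono' _ ?_ (hx.const_mul_atTop (half_pos hc))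
  filter_upwards [hv.def (half_pos hc), hx.eventually_ge_atTop 0] with n hvn hxn
  rw [Real.norm_of_nonneg hxn] at hvn
  linarith [le_of_abs_le hvn]

theorem isLittleO_exp_neg_const_mul {x v : ℕ → ℝ} (hx : Tendsto x atTop atTop)
    (hv : v =o[atTop] x) {c : ℝ} (hc : 0 < c) :
    (fun n => Real.exp (-(c * x n))) =o[atTop] fun n => Real.exp (-v n) := by
  rw [Real.isLittleO_exp_comp_exp_comp]
  exact (tendsto_const_mul_sub_atTop hx hv hc).congr fun n => by ring

theorem isLittleO_exp_sub_mul_natCast (κ : ℝ) :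
    (fun n : ℕ => Real.exp (n / 2 - (4 * |κ| + 6) * n / 4)) =o[atTop] fun n : ℕ =>
      Real.exp (-(κ * n)) := by
  rw [Real.isLittleO_exp_comp_exp_comp]
  refine tendsto_atTop_mono (fun n => ?_) (tendsto_natCast_atTop_atTop (R := ℝ))
  have : κ * n ≤ |κ| * n := by gcongr; exact le_abs_self κ
  linarith

theorem exp_mul_exp_neg_rpow_le {n k K : ℝ} (hK : 0 ≤ K) (hk : k ≤ n / 2) :
    Real.exp (n / 2) * Real.exp (-K) ^ ((n - k) / 2) ≤ Real.exp (n / 2 - K * n / 4) := by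
  rw [← Real.exp_mul, ← Real.exp_add, Real.exp_le_exp]
  linarith [mul_le_mul_of_nonneg_left hk hK]

theorem isLittleO_rpow_rpow_atTop {a b : ℝ} (hab : a < b) :
    (fun x : ℝ => x ^ a) =o[atTop] fun x => x ^ b := by
  refine isLittleO_of_tendsto' ?_ ((tendsto_rpow_neg_atTop (sub_pos.2 hab)).congr' ?_)
  · filter_upwards [eventually_gt_atTop 0] with x hx h
    exact absurd h (Real.rpow_pos_of_pos hx b).ne'
  · filter_upwards [eventually_gt_atTop 0] with x hx
    rw [← Real.rpow_sub hx, neg_sub]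

theorem min_le_log_one_add {x K : ℝ} (hx : 0 ≤ x) :
    min (x / (1 + Real.exp K)) K ≤ Real.log (1 + x) := by
  rcases le_total x (Real.exp K) with hle | hge
  · calc min (x / (1 + Real.exp K)) K ≤ x / (1 + Real.exp K) := min_le_left _ _
      _ ≤ x / (1 + x) := by gcongr
      _ = 1 - (1 + x)⁻¹ := by field_simp; ring
      _ ≤ Real.log (1 + x) := Real.one_sub_inv_le_log_of_pos (by positivity)
  · exact (min_le_right _ _).trans ((Real.le_log_iff_exp_le (by positivity)).2 (by linarith))

theorem one_add_div_rpow_neg_le_exp {c N x K : ℝ} (hc : 0 < c) (hN : 0 < N) (hx : 0 ≤ x) :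
    (1 + x / (c * N)) ^ (-(N / 2)) ≤
      Real.exp (-min ((2 * c * (1 + Real.exp K))⁻¹ * x) (K * N / 2)) := by
  have hlog := mul_le_mul_of_nonneg_left
    (min_le_log_one_add (K := K) (show 0 ≤ x / (c * N) by positivity)) (half_pos hN).le
  rw [mul_min_of_nonneg _ _ (half_pos hN).le] at hlog
  rw [Real.rpow_def_of_pos (by positivity), Real.exp_le_exp, mul_neg, neg_le_neg_iff,
    mul_comm (Real.log _)]
  refine le_of_eq_of_le (congrArg₂ min ?_ ?_) hlog
  · field_simp
  · ring

section Problems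

variable {D : (n : ℕ) → Problem n} {φ : ℝ} {m : (n : ℕ) → Finset (Fin (D n).p)}

theorem CondB1.isLittleO_pbar_natCast (hB1 : CondB1 D) :
    (fun n => ((D n).pbar : ℝ)) =o[atTop] fun n => (n : ℝ) :=
  hB1.1.trans_le fun n => by
    rw [Real.norm_of_nonneg (by positivity), Real.norm_of_nonneg (by positivity)]
    exact min_le_left _ _

theorem CondD2.eventually_lam_le (hD2 : CondD2 φ D) :
    ∀ᶠ n in atTop, (D n).lam φ ∅ ≤ (D n).tau * (D n).rhoMin := by
  filter_upwards [hD2.def one_pos] with n hn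
  rw [one_mul, Real.norm_of_nonneg (mul_nonneg (D n).tau_pos.le (D n).rhoMin_nonneg)] at hn
  exact le_of_abs_le hn

theorem one_le_card_union {n : ℕ} {D : Problem n} {m : Finset (Fin D.p)} (hm : D.NonSpurious m) :
    (1 : ℝ) ≤ ((D.t ∪ m).card : ℝ) := by
  obtain ⟨x, hx, -⟩ := Finset.not_subset.1 hm.1
  exact_mod_cast (Finset.card_pos.2 ⟨x, Finset.mem_union_left m hx⟩ : 0 < (D.t ∪ m).card)

theorem CondB2.eventually_mul_card_le_lam (hφ : 0 < φ) (hB2 : CondB2 φ D) (C : ℝ) :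
    ∀ᶠ n in atTop, ∀ m, (D n).NonSpurious m → C * (((D n).t ∪ m).card : ℝ) ≤ (D n).lam φ m := by
  obtain ⟨β, hβ, h⟩ := hB2
  filter_upwards [h (max C 1) (by positivity)] with n hn m hm
  have hlam := (D n).lam_nonneg hφ hm.2
  have hcard := one_le_card_union hm
  have hle : max C 1 * (((D n).t ∪ m).card : ℝ) ≤ (D n).lam φ m ^ β := hn m hm
  have hone : 1 ≤ (D n).lam φ m ^ β :=
    (one_le_mul_of_one_le_of_one_le (le_max_right C 1) hcard).trans hle
  have hlam1 : 1 ≤ (D n).lam φ m :=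
    not_lt.1 fun hlt => hone.not_gt (Real.rpow_lt_one hlam hlt hβ.1)
  calc C * (((D n).t ∪ m).card : ℝ) ≤ max C 1 * (((D n).t ∪ m).card : ℝ) := by
        gcongr
        exact le_max_left _ _
    _ ≤ (D n).lam φ m ^ β := hle
    _ ≤ (D n).lam φ m := Real.rpow_le_self_of_one_le hlam1 hβ.2.le

theorem CondB2.tendsto_lam_atTop (hφ : 0 < φ) (hB2 : CondB2 φ D)
    (hm : ∀ᶠ n in atTop, (D n).NonSpurious (m n)) :
    Tendsto (fun n => (D n).lam φ (m n)) atTop atTop := by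
  refine tendsto_atTop.2 fun B => ?_
  filter_upwards [hm, hB2.eventually_mul_card_le_lam hφ |B|] with n hmn hle
  exact (le_abs_self B).trans ((le_mul_of_one_le_right (abs_nonneg B)
    (one_le_card_union hmn)).trans (hle _ hmn))

theorem eventually_mul_card_le_rhoMin (hφ : 0 < φ) (hB2 : CondB2 φ D) (hD2 : CondD2 φ D) (C : ℝ) :
    ∀ᶠ n in atTop, C * ((D n).t.card : ℝ) ≤ (D n).tau * (D n).rhoMin := by
  filter_upwards [hD2.eventually_lam_le, hB2.eventually_mul_card_le_lam hφ C] with n hD2n hB2n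
  rcases eq_or_ne (D n).t ∅ with ht | ht
  · rw [ht, Finset.card_empty, Nat.cast_zero, mul_zero]
    exact mul_nonneg (D n).tau_pos.le (D n).rhoMin_nonneg
  · have hle := hB2n ∅ ⟨fun h => ht (Finset.subset_empty.1 h), Nat.zero_le _⟩
    rw [Finset.union_empty] at hle
    exact hle.trans hD2n

theorem Problem.rhoTail_nonneg {n : ℕ} (D : Problem n) : 0 ≤ D.rhoTail := by
  rw [rhoTail]
  split_ifs
  · exact le_rfl
  · exact Real.exp_nonneg _

theorem isLittleO_shrinkageTail (hφ : 0 < φ) (hB2 : CondB2 φ D) (hD2 : CondD2 φ D) :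
    (fun n => (D n).shrinkageTail) =o[atTop] fun n => (D n).rhoTail := by
  refine isLittleO_iff.2 fun c hc => ?_
  filter_upwards [eventually_mul_card_le_rhoMin hφ hB2 hD2 (1 + 2 * |Real.log c|)] with n hn
  rw [Problem.shrinkageTail, Problem.rhoTail]
  split_ifs with ht
  · simp
  have hcard : (1 : ℝ) ≤ ((D n).t.card : ℝ) := by
    exact_mod_cast (Finset.nonempty_iff_ne_empty.2 ht).card_pos
  have hlog := le_mul_of_one_le_right (abs_nonneg (Real.log c)) hcard
  rw [Real.norm_of_nonneg (Real.exp_nonneg _), Real.norm_of_nonneg (Real.exp_nonneg _)]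
  calc Real.exp ((D n).t.card / 2 - (D n).tau * (D n).rhoMin)
      ≤ Real.exp (Real.log c + -((D n).tau * (D n).rhoMin / 2)) := by
        rw [Real.exp_le_exp]
        linarith [neg_abs_le (Real.log c)]
    _ = c * Real.exp (-((D n).tau * (D n).rhoMin / 2)) := by rw [Real.exp_add, Real.exp_log hc]

theorem CondD1.exists_eventually_le (hD1 : CondD1 D m)
    (hm : ∀ᶠ n in atTop, (m n).card ≤ (D n).pbar) :
    ∃ c > (0 : ℝ), ∃ C > (0 : ℝ), ∀ᶠ n in atTop, (D n).rhoProd (D n).t / (D n).rhoProd (m n) ≤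
      C * (c * (D n).tau) ^ (-((D n).sizeDiff (m n) / 2)) := by
  obtain ⟨c, hc, h⟩ := hD1
  obtain ⟨C, hC, hle⟩ := h.2.exists_pos
  refine ⟨c, hc, C, hC, ?_⟩
  filter_upwards [hle.bound, hm] with n hn hmn
  have hrm := (D n).rhoProd_pos hmn
  have hrt := (D n).rhoProd_pos (D n).t_card
  have hτ := mul_pos hc (D n).tau_pos
  have hpow := Real.rpow_pos_of_pos hτ ((D n).sizeDiff (m n) / 2)
  rw [Real.norm_of_nonneg hpow.le, Real.norm_of_nonneg (by positivity), ← mul_div_assoc,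
    le_div_iff₀ hrt] at hn
  rw [Real.rpow_neg hτ.le, ← div_eq_mul_inv, div_le_div_iff₀ hrm hpow]
  linarith

end Problems

end Asymptotics

section Spurious

theorem odds_mul_rpow_le {o r τ c C α β s δ : ℝ} (ho : 0 < o) (hr : 0 ≤ r) (hτ : 0 < τ)
    (hc : 0 < c) (hC : 0 < C) (hs : 0 < s) (hαs : α < s)
    (hrle : r ≤ C * (c * τ) ^ (-(δ / 2))) (hole : o ≤ τ ^ (β * δ / 2)) :
    (o * r) ^ s ≤ C ^ s * (o ^ α * τ ^ (α * -δ / 2)) *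
      (c ^ (-(s / 2)) * τ ^ (-((1 - β) * (s - α) / 2))) ^ δ := by
  set z := o * τ ^ (-(δ / 2)) with hz
  have hz0 : 0 < z := by positivity
  have hproduct : o * r ≤ C * c ^ (-(δ / 2)) * z := by
    calc o * r ≤ o * (C * (c * τ) ^ (-(δ / 2))) := by gcongr
      _ = C * c ^ (-(δ / 2)) * z := by rw [Real.mul_rpow hc.le hτ.le, hz]; ring
  have hzle : z ≤ τ ^ (-((1 - β) * δ / 2)) := by
    calc z ≤ τ ^ (β * δ / 2) * τ ^ (-(δ / 2)) := by rw [hz]; gcongr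
      _ = τ ^ (-((1 - β) * δ / 2)) := by rw [← Real.rpow_add hτ]; congr 1; ring
  have hgain : z ^ (s - α) ≤ (τ ^ (-((1 - β) * (s - α) / 2))) ^ δ := by
    refine (Real.rpow_le_rpow hz0.le hzle (sub_pos.2 hαs).le).trans_eq ?_
    rw [← Real.rpow_mul hτ.le, ← Real.rpow_mul hτ.le]
    congr 1
    ring
  have hzα : z ^ α = o ^ α * τ ^ (α * -δ / 2) := by
    rw [hz, Real.mul_rpow ho.le (by positivity), ← Real.rpow_mul hτ.le]
    congr 2
    ring
  have hcs : (c ^ (-(δ / 2))) ^ s = (c ^ (-(s / 2))) ^ δ := by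
    rw [← Real.rpow_mul hc.le, ← Real.rpow_mul hc.le]
    congr 1
    ring
  calc (o * r) ^ s ≤ (C * c ^ (-(δ / 2)) * z) ^ s := by gcongr
    _ = C ^ s * (c ^ (-(s / 2))) ^ δ * (z ^ α * z ^ (s - α)) := by
      rw [← Real.rpow_add hz0, add_sub_cancel, Real.mul_rpow (by positivity) hz0.le,
        Real.mul_rpow hC.le (by positivity), hcs]
    _ ≤ C ^ s * (c ^ (-(s / 2))) ^ δ * (z ^ α * (τ ^ (-((1 - β) * (s - α) / 2))) ^ δ) := by
      gcongr
    _ = _ := by rw [hzα, Real.mul_rpow (by positivity) (by positivity)]; ring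

variable {D : (n : ℕ) → Problem n} {φ : ℝ} {m : (n : ℕ) → Finset (Fin (D n).p)}

theorem one_le_sizeDiff {n : ℕ} {D : Problem n} {m : Finset (Fin D.p)} (hm : D.Spurious m) :
    1 ≤ D.sizeDiff m := by
  have hlt : (D.t.card : ℝ) + 1 ≤ m.card := by exact_mod_cast Finset.card_lt_card hm.1
  rw [Problem.sizeDiff]
  linarith

/-- As `α < s`, the excess power of `τ` beats every factor that is exponential in `p_m - p_t`. -/
theorem isLittleO_odds_mul_rpow (hm : ∀ᶠ n in atTop, (D n).Spurious (m n)) (hC1 : CondC1 D m)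
    (hD1 : CondD1 D m) {α s b : ℝ} (hs : 0 < s) (hαs : α < s) (hb : 0 < b) :
    (fun n => ((D n).odds (m n) * ((D n).rhoProd (D n).t / (D n).rhoProd (m n))) ^ s *
      b ^ (D n).sizeDiff (m n)) =o[atTop] fun n =>
      (D n).odds (m n) ^ α * (D n).tau ^ (α * -(D n).sizeDiff (m n) / 2) := by
  obtain ⟨hτ, β, hβ, hodds⟩ := hC1
  obtain ⟨c, hc, C, hC, hratio⟩ := hD1.exists_eventually_le (hm.mono fun n h => h.2)
  set γ := (1 - β) * (s - α) / 2
  have hγ : 0 < γ := half_pos (mul_pos (sub_pos.2 hβ.2) (sub_pos.2 hαs))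
  have hdecay : Tendsto (fun n => c ^ (-(s / 2)) * b * (D n).tau ^ (-γ)) atTop (nhds 0) := by
    simpa only [mul_zero, Function.comp_def] using
      ((tendsto_rpow_neg_atTop hγ).comp hτ).const_mul (c ^ (-(s / 2)) * b)
  have hlittle := (isBigO_refl (fun n => (D n).odds (m n) ^ α *
    (D n).tau ^ (α * -(D n).sizeDiff (m n) / 2)) atTop).mul_isLittleO
      ((isLittleO_one_iff ℝ).2 hdecay)
  simp only [mul_one] at hlittle
  refine (IsBigO.of_bound (C ^ s) ?_).trans_isLittleO hlittle
  filter_upwards [hm, hratio, hodds.def one_pos, hdecay.eventually_le_const one_pos]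
    with n hmn hratio hodds hdecay
  have hτ0 := (D n).tau_pos
  have ho := (D n).odds_pos hmn.2
  have hr : 0 < (D n).rhoProd (D n).t / (D n).rhoProd (m n) :=
    div_pos ((D n).rhoProd_pos (D n).t_card) ((D n).rhoProd_pos hmn.2)
  rw [Real.norm_of_nonneg ho.le, Real.norm_of_nonneg (by positivity), one_mul] at hodds
  rw [Real.norm_of_nonneg (by positivity), Real.norm_of_nonneg (by positivity), ← mul_assoc]
  set δ := (D n).sizeDiff (m n)
  calc _ ≤ C ^ s * ((D n).odds (m n) ^ α * (D n).tau ^ (α * -δ / 2)) *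
        (c ^ (-(s / 2)) * (D n).tau ^ (-γ)) ^ δ * b ^ δ := by
        gcongr
        exact odds_mul_rpow_le ho hr.le hτ0 hc hC hs hαs hratio hodds
    _ = C ^ s * ((D n).odds (m n) ^ α * (D n).tau ^ (α * -δ / 2)) *
        (c ^ (-(s / 2)) * b * (D n).tau ^ (-γ)) ^ δ := by
        rw [mul_assoc, ← Real.mul_rpow (by positivity) hb.le, mul_right_comm (c ^ _) b]
    _ ≤ _ := by
        gcongr
        exact (Real.rpow_le_rpow_of_exponent_ge (by positivity) hdecay
          (one_le_sizeDiff hmn)).trans_eq (Real.rpow_one _)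

theorem eventually_mul_add_le {a s s' : ℝ}
    (hpbar : (fun n => ((D n).pbar : ℝ)) =o[atTop] fun n => (n : ℝ))
    (hm : ∀ᶠ n in atTop, (m n).card ≤ (D n).pbar) (hs' : 0 ≤ s') (hss' : s < s') :
    ∀ᶠ n : ℕ in atTop, s * (n + a) ≤ s' * (n - (m n).card) := by
  have hε : 0 < (s' - s) / 2 := half_pos (sub_pos.2 hss')
  filter_upwards [hm, hpbar.def (div_pos hε (show 0 < s' + 1 by positivity)),
    (tendsto_natCast_atTop_atTop.const_mul_atTop hε).eventually_ge_atTop (s * a)] with n hmn hp hna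
  have hcard : ((m n).card : ℝ) ≤ (D n).pbar := Nat.cast_le.2 hmn
  rw [Real.norm_natCast, Real.norm_natCast, div_mul_eq_mul_div, le_div_iff₀ (by positivity)] at hp
  have hs'card : s' * ((m n).card : ℝ) ≤ (D n).pbar * (s' + 1) := by
    nlinarith [(Nat.cast_nonneg (D n).pbar : (0 : ℝ) ≤ _)]
  linarith

theorem eventually_meanPosterior_le_of_spurious {a l e s s' : ℝ} (ha : 0 < a) (hl : 0 < l)
    (hφ : 0 < φ) (hpbar : (fun n => ((D n).pbar : ℝ)) =o[atTop] fun n => (n : ℝ))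
    (hD2 : CondD2 φ D) (hm : ∀ᶠ n in atTop, (D n).Spurious (m n)) (he : e ∈ Ioc (0 : ℝ) 1)
    (hs : 0 ≤ s) (hss' : s < s') (hs' : s' < 1) :
    ∀ᶠ n in atTop, (D n).meanPosterior a l φ (m n) ≤ (D n).shrinkageTail +
      Real.exp (n / 2) * e ^ (((n : ℝ) - (D n).t.card) / 2) +
      Real.exp (10 / e * (1 + a) / 2) * envelopeConst s' *
        (((D n).odds (m n) * ((D n).rhoProd (D n).t / (D n).rhoProd (m n))) ^ s *
          ((1 - s') ^ (-(1 / 2) : ℝ)) ^ (D n).sizeDiff (m n)) := by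
  have hs'0 : 0 ≤ s' := hs.trans hss'.le
  filter_upwards [hm, hD2.eventually_lam_le, eventually_gt_atTop 0, hpbar.def one_half_pos,
    eventually_mul_add_le (a := a) hpbar (hm.mono fun n h => h.2) hs'0 hss']
    with n hmn hlam hn hp hss
  have hn0 : (0 : ℝ) < n := by exact_mod_cast hn
  have hcard : (m n).card < n := by
    rw [Real.norm_natCast, Real.norm_natCast] at hp
    have : ((m n).card : ℝ) < n := (Nat.cast_le.2 hmn.2).trans_lt (by linarith)
    exact_mod_cast this
  refine ((D n).meanPosterior_le_of_spurious ha hl hφ hmn hn hlam he ⟨hs, (hss'.trans hs').le⟩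
    ⟨hs'0, hs'⟩ hcard hss).trans_eq ?_
  rw [← Real.rpow_mul (sub_pos.2 hs').le, neg_mul, one_div_mul_eq_div]
  ring

theorem isLittleO_meanPosterior_of_spurious {a l : ℝ} (ha : 0 < a) (hl : 0 < l) (hφ : 0 < φ)
    (hpbar : (fun n => ((D n).pbar : ℝ)) =o[atTop] fun n => (n : ℝ)) (hB2 : CondB2 φ D)
    (hD2 : CondD2 φ D) (hm : ∀ᶠ n in atTop, (D n).Spurious (m n)) (hC1 : CondC1 D m)
    (hD1 : CondD1 D m) {α : ℝ} (hα : α < 1) (κ : ℝ) :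
    (fun n => (D n).meanPosterior a l φ (m n)) =o[atTop] fun n =>
      max (max ((D n).odds (m n) ^ α * (D n).tau ^ (α * (-(D n).sizeDiff (m n)) / 2))
        (Real.exp (-(κ * n)))) (D n).rhoTail := by
  obtain ⟨s, hαs, hs⟩ := exists_between (max_lt hα one_pos)
  obtain ⟨s', hss', hs'⟩ := exists_between hs
  obtain ⟨hαs, hs0⟩ := max_lt_iff.1 hαs
  set K := 4 * |κ| + 6
  have hK0 : 0 ≤ K := by positivity
  have hrss : (fun n : ℕ => Real.exp (n / 2) *
      Real.exp (-K) ^ (((n : ℝ) - (D n).t.card) / 2)) =o[atTop] fun n : ℕ =>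
      Real.exp (-(κ * n)) := by
    refine (isBigO_of_eventually_mem_Icc ?_).trans_isLittleO (isLittleO_exp_sub_mul_natCast κ)
    filter_upwards [hpbar.def one_half_pos] with n hn
    rw [Real.norm_natCast, Real.norm_natCast] at hn
    have ht : ((D n).t.card : ℝ) ≤ (D n).pbar := Nat.cast_le.2 (D n).t_card
    exact ⟨by positivity, exp_mul_exp_neg_rpow_le hK0 (by linarith)⟩
  have hratio := (isLittleO_odds_mul_rpow hm hC1 hD1 hs0 hαs
    (Real.rpow_pos_of_pos (sub_pos.2 hs') (-(1 / 2)))).const_mul_left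
      (Real.exp (10 / Real.exp (-K) * (1 + a) / 2) * envelopeConst s')
  have hbound := eventually_meanPosterior_le_of_spurious ha hl hφ hpbar hD2 hm
    ⟨Real.exp_pos (-K), Real.exp_le_one_iff.2 (neg_nonpos.2 hK0)⟩ hs0.le hss' hs'
  refine (isBigO_of_eventually_mem_Icc (hbound.mono fun n hn =>
    ⟨(D n).meanPosterior_nonneg a l φ (m n), hn⟩)).trans_isLittleO
      ((((isLittleO_shrinkageTail hφ hB2 hD2).trans_isBigO ?_).add (hrss.trans_isBigO ?_)).add
        (hratio.trans_isBigO ?_))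
  · exact isBigO_of_eventually_mem_Icc (.of_forall fun n =>
      ⟨(D n).rhoTail_nonneg, le_max_right _ _⟩)
  · exact isBigO_of_eventually_mem_Icc (.of_forall fun n =>
      ⟨Real.exp_nonneg _, (le_max_right _ _).trans (le_max_left _ _)⟩)
  · refine isBigO_of_eventually_mem_Icc (hm.mono fun n hmn => ?_)
    have ho := (D n).odds_pos hmn.2
    have hτ := (D n).tau_pos
    exact ⟨by positivity, (le_max_left _ _).trans (le_max_left _ _)⟩

end Spurious

section NonSpurious

theorem odds_mul_le_exp {o r τ c C δ q : ℝ} (ho : 0 < o) (hc : 0 < c)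
    (hτ : Real.exp (4 * |Real.log c| + 4) ≤ τ) (hq : 0 ≤ q)
    (hr : r ≤ C * (c * τ) ^ (-(δ / 2))) (hC : 0 ≤ C) (hpos : 0 < q + δ * Real.log (1 + τ))
    (hlog : Real.log o ≤ 1 / 4 * (q + δ * Real.log (1 + τ))) :
    o * r ≤ C * Real.exp (2 * q) := by
  have hτ0 : 0 < τ := (Real.exp_pos _).trans_le hτ
  have hlogτ : 4 * |Real.log c| + 4 ≤ Real.log τ := (Real.le_log_iff_exp_le hτ0).2 hτ
  have hτ1 : 1 ≤ τ := (Real.one_le_exp (by positivity)).trans hτ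
  have hupper : Real.log (1 + τ) ≤ 1 + Real.log τ := by
    calc Real.log (1 + τ) ≤ Real.log (Real.exp 1 * τ) :=
          Real.log_le_log (by positivity) (by nlinarith [Real.add_one_le_exp 1])
      _ = 1 + Real.log τ := by rw [Real.log_mul (Real.exp_pos _).ne' hτ0.ne', Real.log_exp]
  have hlower : Real.log τ ≤ Real.log (1 + τ) := Real.log_le_log hτ0 (by linarith)
  have habs := abs_nonneg (Real.log c)
  have hexponent : Real.log o - δ / 2 * (Real.log c + Real.log τ) ≤ 2 * q := by
    rcases le_total 0 δ with hδ | hδ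
    · have hgain : δ * (1 / 4 * Real.log (1 + τ) - 1 / 2 * (Real.log c + Real.log τ)) ≤ 0 :=
        mul_nonpos_of_nonneg_of_nonpos hδ (by linarith [neg_abs_le (Real.log c)])
      linarith
    · have hloss : 0 ≤ -δ * (Real.log (1 + τ) - 1 / 2 * (Real.log c + Real.log τ)) :=
        mul_nonneg (by linarith) (by linarith [le_abs_self (Real.log c)])
      have hsize : 0 ≤ -δ * Real.log (1 + τ) := mul_nonneg (by linarith) (by linarith)
      linarith
  calc o * r ≤ o * (C * (c * τ) ^ (-(δ / 2))) := by gcongr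
    _ = C * Real.exp (Real.log o - δ / 2 * (Real.log c + Real.log τ)) := by
      rw [Real.rpow_def_of_pos (by positivity), Real.log_mul hc.ne' hτ0.ne', sub_eq_add_neg,
        Real.exp_add, Real.exp_log ho]
      ring_nf
    _ ≤ C * Real.exp (2 * q) := by gcongr

variable {D : (n : ℕ) → Problem n} {φ : ℝ} {m : (n : ℕ) → Finset (Fin (D n).p)}

theorem tendsto_tau_atTop (hpbar : (fun n => ((D n).pbar : ℝ)) =o[atTop] fun n => (D n).tau)
    (hm : ∀ᶠ n in atTop, (D n).NonSpurious (m n)) :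
    Tendsto (fun n => (D n).tau) atTop atTop := by
  have hone : (fun _ => (1 : ℝ)) =O[atTop] fun n => ((D n).pbar : ℝ) := by
    refine isBigO_of_eventually_mem_Icc (hm.mono fun n hmn => ⟨zero_le_one, ?_⟩)
    obtain ⟨x, hx, -⟩ := Finset.not_subset.1 hmn.1
    exact_mod_cast (Finset.card_pos.2 ⟨x, hx⟩).trans_le (D n).t_card
  refine (isLittleO_one_left_iff ℝ |>.1 (hone.trans_isLittleO hpbar)).congr fun n => ?_
  exact Real.norm_of_nonneg (D n).tau_pos.le

theorem exists_eventually_odds_mul_le_exp {b : ℝ} (hb : b ∈ Ioo (0 : ℝ) 1) (hφ : 0 < φ)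
    (hτ : Tendsto (fun n => (D n).tau) atTop atTop) (hm : ∀ᶠ n in atTop, (D n).NonSpurious (m n))
    (hC2 : CondC2 φ D m) (hD1 : CondD1 D m) :
    ∃ C, ∀ᶠ n in atTop,
      (D n).odds (m n) * ((D n).rhoProd (D n).t / (D n).rhoProd (m n)) ≤
        C * Real.exp (2 * (D n).lam φ (m n) ^ b) := by
  obtain ⟨c, hc, C, hC, hratio⟩ := hD1.exists_eventually_le (hm.mono fun n h => h.2)
  refine ⟨C, ?_⟩
  filter_upwards [hm, hratio, (hC2 b hb).1, (hC2 b hb).2 (1 / 4) (by norm_num),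
    hτ.eventually_ge_atTop (Real.exp (4 * |Real.log c| + 4))]
    with n hmn hratio hpos hlog hτ
  exact odds_mul_le_exp ((D n).odds_pos hmn.2) hc hτ
    (Real.rpow_nonneg ((D n).lam_nonneg hφ hmn.2) b) hratio hC.le hpos hlog

theorem PolySignal.exists_isLittleO_rpow (hS : PolySignal φ D m) :
    ∃ b ∈ Ioo (0 : ℝ) 1, (fun n => (D n).lam φ (m n) ^ b) =o[atTop] fun n => (n : ℝ) := by
  obtain ⟨K, hK⟩ := hS
  have hb : ((K : ℝ) + 2)⁻¹ ∈ Ioo (0 : ℝ) 1 :=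
    ⟨by positivity, inv_lt_one_of_one_lt₀ (by linarith [(Nat.cast_nonneg K : (0 : ℝ) ≤ K)])⟩
  have hlt : (K : ℝ) * ((K : ℝ) + 2)⁻¹ < 1 := by
    rw [mul_inv_lt_iff₀ (by positivity)]
    linarith
  refine ⟨_, hb, (hK.rpow hb.1.le (.of_forall fun n => by positivity)).trans_isLittleO ?_⟩
  have hpow := (isLittleO_rpow_rpow_atTop hlt).comp_tendsto (tendsto_natCast_atTop_atTop (R := ℝ))
  simp only [Function.comp_def, Real.rpow_one] at hpow
  exact hpow.congr_left fun n => Real.rpow_natCast_mul (Nat.cast_nonneg n) K _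

theorem isLittleO_exp_mul_one_add_rpow {x q v : ℕ → ℝ} {c : ℝ} (hc : 0 < c)
    (hx : Tendsto x atTop atTop) (hq : q =o[atTop] x) (hqn : q =o[atTop] fun n => (n : ℝ))
    (hv : v =o[atTop] x) (κ : ℝ) :
    (fun n : ℕ => Real.exp (q n) * (1 + x n / (c * n)) ^ (-((n : ℝ) / 2))) =o[atTop] fun n =>
      Real.exp (-min (v n) (κ * n)) := by
  set K := 2 * (κ + 1)
  set g := (2 * c * (1 + Real.exp K))⁻¹
  have hg : 0 < g := by positivity
  have hsignal : Tendsto (fun n => g * x n - (q n + v n)) atTop atTop :=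
    tendsto_const_mul_sub_atTop hx (hq.add hv) hg
  have hnoise : Tendsto (fun n : ℕ => 1 * (n : ℝ) - q n) atTop atTop :=
    tendsto_const_mul_sub_atTop tendsto_natCast_atTop_atTop hqn one_pos
  have hexp : (fun n : ℕ => Real.exp (q n - min (g * x n) (K * n / 2))) =o[atTop] fun n : ℕ =>
      Real.exp (-min (v n) (κ * n)) := by
    rw [Real.isLittleO_exp_comp_exp_comp]
    refine tendsto_atTop_mono (fun n => ?_) (tendsto_inf_atTop _ hsignal hnoise)
    rcases le_total (g * x n) (K * n / 2) with h | h
    · rw [min_eq_left h]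
      linarith [inf_le_left (a := g * x n - (q n + v n)) (b := 1 * n - q n),
        min_le_left (v n) (κ * n)]
    · rw [min_eq_right h]
      linarith [inf_le_right (a := g * x n - (q n + v n)) (b := 1 * n - q n),
        min_le_right (v n) (κ * n)]
  refine (isBigO_of_eventually_mem_Icc ?_).trans_isLittleO hexp
  filter_upwards [hx.eventually_ge_atTop 0, eventually_gt_atTop 0] with n hxn hn
  have hn0 : (0 : ℝ) < n := Nat.cast_pos.2 hn
  refine ⟨by positivity, ?_⟩
  rw [sub_eq_add_neg, Real.exp_add]
  gcongr
  exact one_add_div_rpow_neg_le_exp hc hn0 hxn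

theorem isLittleO_lam_rpow_lam (hlam : Tendsto (fun n => (D n).lam φ (m n)) atTop atTop) {b : ℝ}
    (hb : b < 1) : (fun n => (D n).lam φ (m n) ^ b) =o[atTop] fun n => (D n).lam φ (m n) := by
  simpa only [Function.comp_def, Real.rpow_one] using
    (isLittleO_rpow_rpow_atTop hb).comp_tendsto hlam

theorem isLittleO_odds_mul_one_add_rpow {v : ℕ → ℝ} {c : ℝ} (hc : 0 < c) (hφ : 0 < φ)
    (hτ : Tendsto (fun n => (D n).tau) atTop atTop) (hm : ∀ᶠ n in atTop, (D n).NonSpurious (m n))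
    (hC2 : CondC2 φ D m) (hD1 : CondD1 D m) (hS : PolySignal φ D m)
    (hlam : Tendsto (fun n => (D n).lam φ (m n)) atTop atTop)
    (hv : v =o[atTop] fun n => (D n).lam φ (m n)) (κ : ℝ) :
    (fun n : ℕ => (D n).odds (m n) * ((D n).rhoProd (D n).t / (D n).rhoProd (m n)) *
      (1 + (D n).lam φ (m n) / (c * n)) ^ (-((n : ℝ) / 2))) =o[atTop] fun n =>
      Real.exp (-min (v n) (κ * n)) := by
  obtain ⟨b, hb, hbn⟩ := hS.exists_isLittleO_rpow
  obtain ⟨C, hodds⟩ := exists_eventually_odds_mul_le_exp hb hφ hτ hm hC2 hD1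
  have hdecay := isLittleO_exp_mul_one_add_rpow hc hlam
    ((isLittleO_lam_rpow_lam hlam hb.2).const_mul_left 2) (hbn.const_mul_left 2) hv κ
  refine (isBigO_of_eventually_mem_Icc ?_).trans_isLittleO (hdecay.const_mul_left C)
  filter_upwards [hm, hodds] with n hmn hoddsn
  have ho := (D n).odds_pos hmn.2
  have hrm := (D n).rhoProd_pos hmn.2
  have hrt := (D n).rhoProd_pos (D n).t_card
  have hlamn := (D n).lam_nonneg hφ hmn.2
  rw [← mul_assoc]
  exact ⟨by positivity, by gcongr⟩

theorem eventually_meanPosterior_le_of_nonSpurious {a l M : ℝ} (ha : 0 < a) (hl : 0 < l)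
    (hφ : 0 < φ) (hM : 0 ≤ M) (hB2 : CondB2 φ D) (hD2 : CondD2 φ D)
    (hm : ∀ᶠ n in atTop, (D n).NonSpurious (m n)) :
    ∀ᶠ n in atTop, (D n).meanPosterior a l φ (m n) ≤ (D n).shrinkageTail +
      Real.exp (n / 2 - M * n / 4) + 2 * Real.exp (-(1 / 128 * (D n).lam φ (m n))) +
      (D n).odds (m n) * ((D n).rhoProd (D n).t / (D n).rhoProd (m n)) *
        (1 + (D n).lam φ (m n) / (2 * (l / φ + M + 10) * n)) ^ (-((n : ℝ) / 2)) := by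
  filter_upwards [hm, hD2.eventually_lam_le, eventually_gt_atTop 0,
    (hB2.tendsto_lam_atTop hφ hm).eventually_ge_atTop 80, hB2.eventually_mul_card_le_lam hφ 32]
    with n hmn hlam₀ hn hlam hcard
  have hproj : Real.exp ((m n).card / 2 - (D n).lam φ (m n) / 32) ≤
      Real.exp (-(1 / 128 * (D n).lam φ (m n))) := by
    have hsub : ((m n).card : ℝ) ≤ ((D n).t ∪ m n).card :=
      Nat.cast_le.2 (Finset.card_le_card Finset.subset_union_right)
    rw [Real.exp_le_exp]
    linarith [hcard _ hmn]
  have hbound := (D n).meanPosterior_le_of_nonSpurious ha hl hφ hM hmn hn hlam₀ hlam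
  rw [← one_div_mul_eq_div 128] at hbound
  linarith

theorem isLittleO_meanPosterior_of_nonSpurious {a l : ℝ} (ha : 0 < a) (hl : 0 < l) (hφ : 0 < φ)
    (hτ : Tendsto (fun n => (D n).tau) atTop atTop) (hB2 : CondB2 φ D) (hD2 : CondD2 φ D)
    (hm : ∀ᶠ n in atTop, (D n).NonSpurious (m n)) (hC2 : CondC2 φ D m) (hD1 : CondD1 D m)
    (hS : PolySignal φ D m) (γ : ℝ) {α : ℝ} (hα : α < 1) (κ : ℝ) :
    (fun n => (D n).meanPosterior a l φ (m n)) =o[atTop] fun n =>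
      Real.exp (-(min (min (γ * (D n).lam φ (m n) ^ α / 2) (κ * n))
        ((D n).tau * (D n).rhoMin / 2))) := by
  have hM : 0 ≤ 4 * |κ| + 6 := by positivity
  have hlam := hB2.tendsto_lam_atTop hφ hm
  have hv : (fun n => γ * (D n).lam φ (m n) ^ α / 2) =o[atTop] fun n => (D n).lam φ (m n) :=
    ((isLittleO_lam_rpow_lam hlam hα).const_mul_left (γ / 2)).congr_left fun n => by ring
  have hbound := eventually_meanPosterior_le_of_nonSpurious ha hl hφ hM hB2 hD2 hm
  have hrate := isLittleO_odds_mul_one_add_rpow (c := 2 * (l / φ + (4 * |κ| + 6) + 10))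
    (by positivity) hφ hτ hm hC2 hD1 hS hlam hv κ
  have hsignal := (isLittleO_exp_neg_const_mul hlam hv (show 0 < (1 / 128 : ℝ) by
    norm_num)).const_mul_left 2
  refine (isBigO_of_eventually_mem_Icc (hbound.mono fun n hn =>
    ⟨(D n).meanPosterior_nonneg a l φ (m n), hn⟩)).trans_isLittleO
      (((((isLittleO_shrinkageTail hφ hB2 hD2).trans_isBigO ?_).add
        ((isLittleO_exp_sub_mul_natCast κ).trans_isBigO ?_)).add (hsignal.trans_isBigO ?_)).add
          (hrate.trans_isBigO ?_)) <;>
    refine isBigO_of_eventually_mem_Icc (.of_forall fun n => ?_)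
  · refine ⟨(D n).rhoTail_nonneg, ?_⟩
    rw [Problem.rhoTail]
    split_ifs
    · exact Real.exp_nonneg _
    · exact Real.exp_le_exp.2 (neg_le_neg (min_le_right _ _))
  · exact ⟨Real.exp_nonneg _,
      Real.exp_le_exp.2 (neg_le_neg ((min_le_left _ _).trans (min_le_right _ _)))⟩
  · exact ⟨Real.exp_nonneg _,
      Real.exp_le_exp.2 (neg_le_neg ((min_le_left _ _).trans (min_le_left _ _)))⟩
  · exact ⟨Real.exp_nonneg _, Real.exp_le_exp.2 (neg_le_neg (min_le_left _ _))⟩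

end NonSpurious

end BMS

end

theorem proposition4_general {a l φ : ℝ} (ha : 0 < a) (hl : 0 < l) (hφ : 0 < φ)
    {D : (n : ℕ) → BMS.Problem n} (hB2 : BMS.CondB2 φ D) (hD2 : BMS.CondD2 φ D) :
    ((fun n => ((D n).pbar : ℝ)) =o[atTop] (fun n => (n : ℝ)) →
      ∀ m : (n : ℕ) → Finset (Fin (D n).p),
      (∀ᶠ n in atTop, (D n).Spurious (m n)) → BMS.CondC1 D m → BMS.CondD1 D m →
      ∀ α < (1 : ℝ), ∀ κ : ℝ,
        (fun n => (D n).meanPosterior a l φ (m n)) =o[atTop] fun n =>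
          max (max ((D n).odds (m n) ^ α * (D n).tau ^ (α * (-(D n).sizeDiff (m n)) / 2))
            (Real.exp (-(κ * n)))) (D n).rhoTail) ∧
    (Tendsto (fun n => (D n).tau) atTop atTop →
      ∀ m : (n : ℕ) → Finset (Fin (D n).p),
      (∀ᶠ n in atTop, (D n).NonSpurious (m n)) → BMS.CondC2 φ D m → BMS.CondD1 D m →
      BMS.PolySignal φ D m →
      ∀ γ : ℝ, ∀ α < (1 : ℝ), ∀ κ : ℝ,
        (fun n => (D n).meanPosterior a l φ (m n)) =o[atTop] fun n =>
          Real.exp (-(min (min (γ * (D n).lam φ (m n) ^ α / 2) (κ * n))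
            ((D n).tau * (D n).rhoMin / 2)))) :=
  ⟨fun hpbar _ hm hC1 hD1 _ hα κ =>
    BMS.isLittleO_meanPosterior_of_spurious ha hl hφ hpbar hB2 hD2 hm hC1 hD1 hα κ,
  fun hτ _ hm hC2 hD1 hS γ _ hα κ =>
    BMS.isLittleO_meanPosterior_of_nonSpurious ha hl hφ hτ hB2 hD2 hm hC2 hD1 hS γ hα κ⟩

theorem proposition4 (a l φ : ℝ) (ha : 0 < a) (hl : 0 < l) (hφ : 0 < φ)
    (D : (n : ℕ) → BMS.Problem n)
    (hB1 : BMS.CondB1 D) (hB2 : BMS.CondB2 φ D) (hD2 : BMS.CondD2 φ D) :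
    (∀ m : (n : ℕ) → Finset (Fin (D n).p),
      (∀ᶠ n in atTop, (D n).Spurious (m n)) → BMS.CondC1 D m → BMS.CondD1 D m →
      ∀ α ∈ Ioo (0 : ℝ) 1, ∀ κ > (0 : ℝ),
        (fun n => (D n).meanPosterior a l φ (m n)) =o[atTop] fun n =>
          max (max ((D n).odds (m n) ^ α * (D n).tau ^ (α * (-(D n).sizeDiff (m n)) / 2))
            (Real.exp (-(κ * n)))) (D n).rhoTail) ∧
    (∀ m : (n : ℕ) → Finset (Fin (D n).p),
      (∀ᶠ n in atTop, (D n).NonSpurious (m n)) → BMS.CondC2 φ D m → BMS.CondD1 D m →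
      BMS.PolySignal φ D m →
      ∀ γ ∈ Ioo (0 : ℝ) 1, ∀ α ∈ Ioo (0 : ℝ) 1, ∀ κ > (0 : ℝ),
        (fun n => (D n).meanPosterior a l φ (m n)) =o[atTop] fun n =>
          Real.exp (-(min (min (γ * (D n).lam φ (m n) ^ α / 2) (κ * n))
            ((D n).tau * (D n).rhoMin / 2)))) := by
  obtain ⟨hspurious, hnonSpurious⟩ := proposition4_general ha hl hφ hB2 hD2
  exact ⟨fun m hm hC1 hD1 α hα κ _ =>
      hspurious hB1.isLittleO_pbar_natCast m hm hC1 hD1 α hα.2 κ,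
    fun m hm hC2 hD1 hS γ _ α hα κ _ =>
      hnonSpurious (BMS.tendsto_tau_atTop hB1.2 hm) m hm hC2 hD1 hS γ α hα.2 κ⟩
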